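/- **Biquandles.** A biquandle is a set $X$ with two binary operations, written $x^y$ and $x_y$, such that for all $x,y,z\in X$: (i) $x^x=x_x$; (ii) the maps $y\mapsto y_x$, $y\mapsto y^x$ and $(x,y)\mapsto(y_x,x^y)$ are bijective; (iii) $(x^y)^{(z^y)}=(x^z)^{(y_z)}$, $(x^y)_{(z^y)}=(x_z)^{(y_z)}$ and $(x_y)_{(z_y)}=(x_z)_{(y^z)}$. **Biquandle virtual brackets.** Let $R$ be a commutative ring with identity. A biquandle virtual bracket $\beta$ consists of maps $A,B,C,D,U,V:X\times X\to R$ and elements $\delta\in R$, $w\in R^\times$ such that for all $x,y,z\in X$ $$w=\delta A_{x,x}+B_{x,x}+V_{x,x},\qquad w^{-1}=\delta C_{x,x}+D_{x,x}+U_{x,x},$$ $$1=A_{x,y}C_{x,y}+V_{x,y}U_{x,y},\quad 1=B_{x,y}D_{x,y}+V_{x,y}U_{x,y},\quad 0=A_{x,y}U_{x,y}+V_{x,y}C_{x,y},\quad 0=B_{x,y}U_{x,y}+V_{x,y}D_{x,y},$$ $$0=\delta B_{x,y}D_{x,y}+A_{x,y}D_{x,y}+B_{x,y}C_{x,y},\qquad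 0=\delta A_{x,y}C_{x,y}+A_{x,y}D_{x,y}+B_{x,y}C_{x,y},$$ and the following fifteen equations hold, where on the left a product $PQS$ stands for $P_{x,y}\,Q_{x^y,z_y}\,S_{y,z}$ and on the right for $P_{y_x,z_x}\,Q_{x,z}\,S_{x^z,y^z}$: $$\begin{aligned} AAA+VAV&=AAA+VAV\\ AAB+BAA+\delta BAB+BAV+BBB+BVB+VAB&=ABA\\ ABA&=AAB+BAA+\delta BAB+BAV+BBB+BVB+VAB\\ AVA&=AAV+VAA\\ AAV+VAA&=AVA\\ BBA+BVV&=ABB+VVB\\ ABB+VVB&=BBA+BVV\\ BBV+BVA&=ABV\\ ABV&=BBV+BVA\\ VBA&=AVB+VBB\\ AVB+VBB&=VBA\\ VVA&=AVV\\ AVV&=VVA\\ VBV&=VBV\\ VVV&=VVV \end{aligned}$$ **Colorings.** Let $D$ be an oriented (classical or) virtual link diagram. An $X$-coloring $f$ of $D$ assigns an element of $X$ to each semiarc such that at each classical crossing there are $x,y\in X$, called the pair of the crossing, with: at a positive crossing the understrand enters with $x$ and leaves with $x^y$, and the overstrand enters with $y_x$ and leaves with $y$; at a negative crossing the understrand enters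 with $x^y$ and leaves with $x$, and the overstrand enters with $y$ and leaves with $y_x$. At virtual crossings the colors run through unchanged. **State sum.** A state $S$ arises by treating every classical crossing of $D$ in one of three ways: smoothing it with the orientation, smoothing it against the orientation, or making it virtual; if $D$ has $c$ classical crossings, there are $3^c$ states. The coefficient of the choice at a crossing with pair $(x,y)$ is respectively $A_{x,y},B_{x,y},V_{x,y}$ if the crossing is positive, and $C_{x,y},D_{x,y},U_{x,y}$ if it is negative. Let $\beta_S$ be the product of these coefficients times $\delta^{k}w^{n-p}$, where $k$ is the number of closed curves of $S$ (which may cross virtually), and $n$ and $p$ are the numbers of negative and positive classical crossings of $D$. Put $\beta_f=\sum_S\beta_S$. **Moves.** The oriented virtual Reidemeister moves are generated by: all oriented versions of the classical moves I and II and of their virtual counterparts (all crossings virtual); the classical move III in which all three strands run in the same direction and all three crossings are positive; and all oriented versions of the move in which a strand with only virtual crossings passes a positive, a negative or a virtual crossing. An $X$-colored move is such a move between two $X$-colored diagrams whose colors agree on all semiarcs outside the disk of the move and on the semiarcs that meet its boundary. **Theorem.** Let $X$ be a biquandle and $\beta$ a biquandle virtual bracket over $X$ with values in a commutative ring $R$.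 For every $X$-coloring $f$ of an oriented classical or virtual link diagram, the state sum $\beta_f$ is invariant under $X$-colored virtual Reidemeister moves: if an $X$-colored diagram $(D',f')$ is obtained from $(D,f)$ by a finite sequence of such moves and their inverses, then $\beta_{f'}=\beta_f$. -/

import Mathlib

/-! ## Biquandles -/

/-- A biquandle: `opUnder x y` is `x` with the underlined triangle operation by `y` (the label `x`
becomes when it passes under `y`, written `x^y`), `opOver x y` is `x` with the overlined triangle
operation by `y` (written `x_y`). -/
class Biquandle (X : Type*) where
  opUnder : X → X → X
  opOver : X → X → X
  under_self : ∀ x, opUnder x x = opOver x x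
  over_bijective : ∀ x, Function.Bijective fun y => opOver y x
  under_bijective : ∀ x, Function.Bijective fun y => opUnder y x
  sideways_bijective :
    Function.Bijective fun p : X × X => ((opOver p.2 p.1, opUnder p.1 p.2) : X × X)
  exchange_under_under : ∀ x y z,
    opUnder (opUnder x y) (opUnder z y) = opUnder (opUnder x z) (opOver y z)
  exchange_under_over : ∀ x y z,
    opOver (opUnder x y) (opUnder z y) = opUnder (opOver x z) (opOver y z)
  exchange_over_over : ∀ x y z,
    opOver (opOver x y) (opOver z y) = opOver (opOver x z) (opUnder y z)

infixl:75 " ▹ᵤ " => Biquandle.opUnder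
infixl:75 " ▹ₒ " => Biquandle.opOver

/-! ## Biquandle virtual brackets -/

/-- A biquandle virtual bracket over a biquandle `X` with values in the commutative ring `R`.
The skein coefficients `A, B, V` belong to positive crossings and `C, D, U` to negative ones, for
the smoothing with the orientation, the smoothing against it, and the replacement by a virtual
crossing, respectively. -/
structure BiquandleVirtualBracket (X : Type*) [Biquandle X] (R : Type*) [CommRing R] where
  A : X → X → R
  B : X → X → R
  C : X → X → R
  D : X → X → R
  U : X → X → R
  V : X → X → R
  δ : R
  w : Rˣ
  i_i : ∀ x, (w : R) = δ * A x x + B x x + V x x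
  i_ii : ∀ x, ((w⁻¹ : Rˣ) : R) = δ * C x x + D x x + U x x
  ii_i : ∀ x y, 1 = A x y * C x y + V x y * U x y
  ii_ii : ∀ x y, 1 = B x y * D x y + V x y * U x y
  ii_iii : ∀ x y, 0 = A x y * U x y + V x y * C x y
  ii_iv : ∀ x y, 0 = B x y * U x y + V x y * D x y
  ii_v : ∀ x y, 0 = δ * B x y * D x y + A x y * D x y + B x y * C x y
  ii_vi : ∀ x y, 0 = δ * A x y * C x y + A x y * D x y + B x y * C x y
  iii_i : ∀ x y z,
    A x y * A (x ▹ᵤ y) (z ▹ₒ y) * A y z + V x y * A (x ▹ᵤ y) (z ▹ₒ y) * V y z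
      = A (y ▹ₒ x) (z ▹ₒ x) * A x z * A (x ▹ᵤ z) (y ▹ᵤ z)
        + V (y ▹ₒ x) (z ▹ₒ x) * A x z * V (x ▹ᵤ z) (y ▹ᵤ z)
  iii_ii : ∀ x y z,
    A x y * A (x ▹ᵤ y) (z ▹ₒ y) * B y z + B x y * A (x ▹ᵤ y) (z ▹ₒ y) * A y z
        + δ * B x y * A (x ▹ᵤ y) (z ▹ₒ y) * B y z + B x y * A (x ▹ᵤ y) (z ▹ₒ y) * V y z
        + B x y * B (x ▹ᵤ y) (z ▹ₒ y) * B y z + B x y * V (x ▹ᵤ y) (z ▹ₒ y) * B y z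
        + V x y * A (x ▹ᵤ y) (z ▹ₒ y) * B y z
      = A (y ▹ₒ x) (z ▹ₒ x) * B x z * A (x ▹ᵤ z) (y ▹ᵤ z)
  iii_iii : ∀ x y z,
    A x y * B (x ▹ᵤ y) (z ▹ₒ y) * A y z
      = A (y ▹ₒ x) (z ▹ₒ x) * A x z * B (x ▹ᵤ z) (y ▹ᵤ z)
        + B (y ▹ₒ x) (z ▹ₒ x) * A x z * A (x ▹ᵤ z) (y ▹ᵤ z)
        + δ * B (y ▹ₒ x) (z ▹ₒ x) * A x z * B (x ▹ᵤ z) (y ▹ᵤ z)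
        + B (y ▹ₒ x) (z ▹ₒ x) * A x z * V (x ▹ᵤ z) (y ▹ᵤ z)
        + B (y ▹ₒ x) (z ▹ₒ x) * B x z * B (x ▹ᵤ z) (y ▹ᵤ z)
        + B (y ▹ₒ x) (z ▹ₒ x) * V x z * B (x ▹ᵤ z) (y ▹ᵤ z)
        + V (y ▹ₒ x) (z ▹ₒ x) * A x z * B (x ▹ᵤ z) (y ▹ᵤ z)
  iii_iv : ∀ x y z,
    A x y * V (x ▹ᵤ y) (z ▹ₒ y) * A y z
      = A (y ▹ₒ x) (z ▹ₒ x) * A x z * V (x ▹ᵤ z) (y ▹ᵤ z)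
        + V (y ▹ₒ x) (z ▹ₒ x) * A x z * A (x ▹ᵤ z) (y ▹ᵤ z)
  iii_v : ∀ x y z,
    A x y * A (x ▹ᵤ y) (z ▹ₒ y) * V y z + V x y * A (x ▹ᵤ y) (z ▹ₒ y) * A y z
      = A (y ▹ₒ x) (z ▹ₒ x) * V x z * A (x ▹ᵤ z) (y ▹ᵤ z)
  iii_vi : ∀ x y z,
    B x y * B (x ▹ᵤ y) (z ▹ₒ y) * A y z + B x y * V (x ▹ᵤ y) (z ▹ₒ y) * V y z
      = A (y ▹ₒ x) (z ▹ₒ x) * B x z * B (x ▹ᵤ z) (y ▹ᵤ z)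
        + V (y ▹ₒ x) (z ▹ₒ x) * V x z * B (x ▹ᵤ z) (y ▹ᵤ z)
  iii_vii : ∀ x y z,
    A x y * B (x ▹ᵤ y) (z ▹ₒ y) * B y z + V x y * V (x ▹ᵤ y) (z ▹ₒ y) * B y z
      = B (y ▹ₒ x) (z ▹ₒ x) * B x z * A (x ▹ᵤ z) (y ▹ᵤ z)
        + B (y ▹ₒ x) (z ▹ₒ x) * V x z * V (x ▹ᵤ z) (y ▹ᵤ z)
  iii_viii : ∀ x y z,
    B x y * B (x ▹ᵤ y) (z ▹ₒ y) * V y z + B x y * V (x ▹ᵤ y) (z ▹ₒ y) * A y z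
      = A (y ▹ₒ x) (z ▹ₒ x) * B x z * V (x ▹ᵤ z) (y ▹ᵤ z)
  iii_ix : ∀ x y z,
    A x y * B (x ▹ᵤ y) (z ▹ₒ y) * V y z
      = B (y ▹ₒ x) (z ▹ₒ x) * B x z * V (x ▹ᵤ z) (y ▹ᵤ z)
        + B (y ▹ₒ x) (z ▹ₒ x) * V x z * A (x ▹ᵤ z) (y ▹ᵤ z)
  iii_x : ∀ x y z,
    V x y * B (x ▹ᵤ y) (z ▹ₒ y) * A y z
      = A (y ▹ₒ x) (z ▹ₒ x) * V x z * B (x ▹ᵤ z) (y ▹ᵤ z)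
        + V (y ▹ₒ x) (z ▹ₒ x) * B x z * B (x ▹ᵤ z) (y ▹ᵤ z)
  iii_xi : ∀ x y z,
    A x y * V (x ▹ᵤ y) (z ▹ₒ y) * B y z + V x y * B (x ▹ᵤ y) (z ▹ₒ y) * B y z
      = V (y ▹ₒ x) (z ▹ₒ x) * B x z * A (x ▹ᵤ z) (y ▹ᵤ z)
  iii_xii : ∀ x y z,
    V x y * V (x ▹ᵤ y) (z ▹ₒ y) * A y z
      = A (y ▹ₒ x) (z ▹ₒ x) * V x z * V (x ▹ᵤ z) (y ▹ᵤ z)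
  iii_xiii : ∀ x y z,
    A x y * V (x ▹ᵤ y) (z ▹ₒ y) * V y z
      = V (y ▹ₒ x) (z ▹ₒ x) * V x z * A (x ▹ᵤ z) (y ▹ᵤ z)
  iii_xiv : ∀ x y z,
    V x y * B (x ▹ᵤ y) (z ▹ₒ y) * V y z
      = V (y ▹ₒ x) (z ▹ₒ x) * B x z * V (x ▹ᵤ z) (y ▹ᵤ z)
  iii_xv : ∀ x y z,
    V x y * V (x ▹ᵤ y) (z ▹ₒ y) * V y z
      = V (y ▹ₒ x) (z ▹ₒ x) * V x z * V (x ▹ᵤ z) (y ▹ᵤ z)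

/-! ## Oriented virtual link diagrams, as planar diagram codes -/

/-- The three kinds of crossings: positive classical, negative classical, virtual. -/
inductive CrossingKind
  | pos
  | neg
  | virt
  deriving DecidableEq

/-- The kind of crossing after the two strands have exchanged over and under. -/
def CrossingKind.flip : CrossingKind → CrossingKind
  | pos => neg
  | neg => pos
  | virt => virt

/-- A vertex of an oriented diagram whose semiarcs carry labels in `L`.

* `crossing k bl br tl tr`: a crossing of kind `k`, turned so that both strands point upwards.
  One strand runs from the bottom left semiarc `bl` to the top right semiarc `tr`, the other from
  the bottom right semiarc `br` to the top left semiarc `tl`. The overstrand is `bl → tr` when the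
  crossing is positive and `br → tl` when it is negative.
* `point s t`: a marked point on a strand, at which the piece `s` ends and the piece `t` begins.
  Marked points have no geometric content; they make crossingless circles visible. -/
inductive Vertex (L : Type*)
  | crossing (k : CrossingKind) (bl br tl tr : L)
  | point (s t : L)

namespace Vertex

variable {L : Type*}

/-- The semiarcs that end at the vertex. -/
def ins : Vertex L → Multiset L
  | crossing _ bl br _ _ => {bl, br}
  | point s _ => {s}

/-- The semiarcs that begin at the vertex. -/
def outs : Vertex L → Multiset L
  | crossing _ _ _ tl tr => {tl, tr}
  | point _ t => {t}

/-- Is the vertex a crossing of the kind `k`? -/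
def IsCrossing (k : CrossingKind) : Vertex L → Prop
  | crossing k' _ _ _ _ => k' = k
  | point _ _ => False

instance (k : CrossingKind) : DecidablePred (IsCrossing (L := L) k)
  | crossing k' _ _ _ _ => inferInstanceAs (Decidable (k' = k))
  | point _ _ => inferInstanceAs (Decidable False)

/-- Rename the labels. -/
def map {L' : Type*} (g : L → L') : Vertex L → Vertex L'
  | crossing k bl br tl tr => crossing k (g bl) (g br) (g tl) (g tr)
  | point s t => point (g s) (g t)

/-- Rename the labels of the semiarcs that end at the vertex, and only these. -/
def mapIns (g : L → L) : Vertex L → Vertex L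
  | crossing k bl br tl tr => crossing k (g bl) (g br) tl tr
  | point s t => point (g s) t

/-- Pairs that connect all semiarcs at the vertex. -/
def links : Vertex L → Multiset (L × L)
  | crossing _ bl br tl tr => {(bl, br), (bl, tl), (bl, tr)}
  | point s t => {(s, t)}

/-- The corners of the vertex. `(e, true)` is the left side and `(e, false)` the right side of the
semiarc `e`; two sides are paired if they face each other in a corner at the vertex. -/
def corners : Vertex L → Multiset ((L × Bool) × (L × Bool))
  | crossing _ bl br tl tr =>
      {((bl, false), (br, true)), ((br, false), (tr, false)),
        ((tr, true), (tl, false)), ((tl, true), (bl, true))}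
  | point s t => {((s, true), (t, true)), ((s, false), (t, false))}

/-- The coloring condition at a vertex. At a positive crossing the understrand enters with `x` and
leaves with `x^y`, the overstrand enters with `y_x` and leaves with `y`; at a negative crossing the
understrand enters with `x^y` and leaves with `x`, the overstrand enters with `y` and leaves with
`y_x`. At virtual crossings and marked points the colors run through unchanged. -/
def IsColored {X : Type*} [Biquandle X] (f : L → X) : Vertex L → Prop
  | crossing .pos bl br tl tr => f tl = f br ▹ᵤ f tr ∧ f bl = f tr ▹ₒ f br
  | crossing .neg bl br tl tr => f bl = f tr ▹ᵤ f br ∧ f tl = f br ▹ₒ f tr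
  | crossing .virt bl br tl tr => f tr = f bl ∧ f tl = f br
  | point s t => f t = f s

/-- The ways to smooth a vertex, each with its coefficient and with the pairs of semiarcs that it
joins: a classical crossing is smoothed with the orientation, smoothed against the orientation, or
made virtual; virtual crossings and marked points stay as they are. -/
def smoothings {X : Type*} [Biquandle X] {R : Type*} [CommRing R]
    (β : BiquandleVirtualBracket X R) (f : L → X) : Vertex L → Multiset (R × Multiset (L × L))
  | crossing .pos bl br tl tr =>
      {(β.A (f br) (f tr), {(bl, tl), (br, tr)}),
        (β.B (f br) (f tr), {(bl, br), (tl, tr)}),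
        (β.V (f br) (f tr), {(bl, tr), (br, tl)})}
  | crossing .neg bl br tl tr =>
      {(β.C (f tr) (f br), {(bl, tl), (br, tr)}),
        (β.D (f tr) (f br), {(bl, br), (tl, tr)}),
        (β.U (f tr) (f br), {(bl, tr), (br, tl)})}
  | crossing .virt bl br tl tr => {(1, {(bl, tr), (br, tl)})}
  | point s t => {(1, {(s, t)})}

end Vertex

/-- The number of classes of the elements of `S` under the equivalence relation that the pairs in
`r` generate. -/
noncomputable def numClasses {T : Type*} (S : Multiset T) (r : Multiset (T × T)) : ℕ :=
  Nat.card (Quot fun a b : {t : T // t ∈ S} => (a.1, b.1) ∈ r)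

/-- The underlying data of a diagram or of a part of one: its vertices. -/
abbrev DiagramCode (L : Type*) := Multiset (Vertex L)

namespace DiagramCode

variable {L : Type*}

/-- The semiarcs that end at a vertex of the code. -/
def ins (D : DiagramCode L) : Multiset L := D.bind Vertex.ins

/-- The semiarcs that begin at a vertex of the code. -/
def outs (D : DiagramCode L) : Multiset L := D.bind Vertex.outs

/-- The number of crossings of a kind. -/
def numCrossings (k : CrossingKind) (D : DiagramCode L) : ℕ := D.countP (Vertex.IsCrossing k)

/-- The number of connected pieces of the underlying graph. -/
noncomputable def numPieces (D : DiagramCode L) : ℕ := numClasses D.outs (D.bind Vertex.links)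

/-- The number of faces when every connected piece is drawn on its own closed surface, with disk
faces: the number of classes of sides of semiarcs under the pairing in corners. -/
noncomputable def numFaces (D : DiagramCode L) : ℕ :=
  numClasses (D.outs ×ˢ ({true, false} : Multiset Bool)) (D.bind Vertex.corners)

end DiagramCode

/-- An oriented virtual link diagram with semiarcs labelled in `L`: every label in use belongs to
exactly one semiarc, which begins at one vertex and ends at one vertex, and the diagram is planar.
Planarity is Euler's formula `#vertices - #semiarcs + #faces = 2 * #pieces`, where
`#semiarcs - #vertices` is the number of classical and virtual crossings. The diagram is classical
when it has no virtual crossings. -/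
structure VirtualLinkDiagram (L : Type*) where
  code : DiagramCode L
  nodup : code.outs.Nodup
  closed : code.ins = code.outs
  planar : code.numFaces =
    code.numCrossings .pos + code.numCrossings .neg + code.numCrossings .virt + 2 * code.numPieces

/-- A virtual link diagram with an `X`-coloring. (Values of `color` at labels that the diagram does
not use are irrelevant.) -/
structure ColoredDiagram (X : Type*) [Biquandle X] (L : Type*) extends VirtualLinkDiagram L where
  color : L → X
  isColored : ∀ v ∈ code, v.IsColored color

/-! ## The state sum -/

namespace ColoredDiagram

variable {X : Type*} [Biquandle X] {R : Type*} [CommRing R] {L : Type*}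

/-- The states: one smoothing for every vertex, in all possible ways. -/
def states (K : ColoredDiagram X L) (β : BiquandleVirtualBracket X R) :
    Multiset (Multiset (R × Multiset (L × L))) :=
  (K.code.map (Vertex.smoothings β K.color)).Sections

/-- The number of closed curves of a state. -/
noncomputable def numComponents (K : ColoredDiagram X L)
    (S : Multiset (R × Multiset (L × L))) : ℕ :=
  numClasses K.code.outs (S.bind Prod.snd)

/-- The writhe correction `w ^ (n - p)`. -/
def writheFactor (K : ColoredDiagram X L) (β : BiquandleVirtualBracket X R) : R :=
  ((β.w ^ ((K.code.numCrossings .neg : ℤ) - (K.code.numCrossings .pos : ℤ)) : Rˣ) : R)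

/-- The value `β_S` of a state. -/
noncomputable def stateValue (K : ColoredDiagram X L) (β : BiquandleVirtualBracket X R)
    (S : Multiset (R × Multiset (L × L))) : R :=
  (S.map Prod.fst).prod * β.δ ^ K.numComponents S * K.writheFactor β

/-- The state sum `β_f`. -/
noncomputable def stateSum (K : ColoredDiagram X L) (β : BiquandleVirtualBracket X R) : R :=
  ((K.states β).map (K.stateValue β)).sum

end ColoredDiagram

/-! ## The oriented virtual Reidemeister moves -/

/-- `LocalMove P T T'`: the tangle `T` is replaced by the tangle `T'`, both with the boundary
semiarcs `P`. The moves with `k = pos` or `k = neg` are classical or mixed ones, those with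
`k = virt` are the purely virtual ones. -/
inductive LocalMove {L : Type*} : Multiset L → DiagramCode L → DiagramCode L → Prop
  /-- Moves I and vI, the loop is on the right. -/
  | kinkRight (k : CrossingKind) (a b e : L) :
      LocalMove {a, b} {.point a b} {.crossing k a e b e}
  /-- Moves I and vI, the loop is on the left. -/
  | kinkLeft (k : CrossingKind) (a b e : L) :
      LocalMove {a, b} {.point a b} {.crossing k e a e b}
  /-- Moves II and vII, direct: both strands point upwards. -/
  | direct (k : CrossingKind) (a b c d p q : L) :
      LocalMove {a, b, c, d} {.point a c, .point b d}
        {.crossing k a b p q, .crossing k.flip p q c d}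
  /-- Moves II and vII, reverse: the strand `a → c` on the left points upwards, the strand
  `d → b` on the right points downwards. -/
  | reverseUpDown (k : CrossingKind) (a b c d p q : L) :
      LocalMove {a, b, c, d} {.point a c, .point d b}
        {.crossing k q a p b, .crossing k.flip p d q c}
  /-- Moves II and vII, reverse: the strand `d → b` on the left points downwards, the strand
  `a → c` on the right points upwards. -/
  | reverseDownUp (k : CrossingKind) (a b c d p q : L) :
      LocalMove {a, b, c, d} {.point a c, .point d b}
        {.crossing k a q b p, .crossing k.flip d p c q}
  /-- Move III: all three strands point upwards and all three crossings are positive. -/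
  | braid (a b c d e f p q r p' q' r' : L) :
      LocalMove {a, b, c, d, e, f}
        {.crossing .pos b c p q, .crossing .pos a p d r, .crossing .pos r q e f}
        {.crossing .pos a b p' q', .crossing .pos q' c r' f, .crossing .pos p' r' d e}
  /-- Moves v and vIII: a virtual strand `a → f` from left to right passes a crossing. -/
  | slideRight (k : CrossingKind) (a b c d e f p q r p' q' r' : L) :
      LocalMove {a, b, c, d, e, f}
        {.crossing k b c p q, .crossing .virt a p d r, .crossing .virt r q e f}
        {.crossing .virt a b p' q', .crossing .virt q' c r' f, .crossing k p' r' d e}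
  /-- Moves v and vIII: a virtual strand `c → d` from right to left passes a crossing. -/
  | slideLeft (k : CrossingKind) (a b c d e f p q r p' q' r' : L) :
      LocalMove {a, b, c, d, e, f}
        {.crossing k a b p q, .crossing .virt q c r f, .crossing .virt p r d e}
        {.crossing .virt b c p' q', .crossing .virt a p' d r', .crossing k r' q' e f}
  /-- Moves v and vIII: a virtual strand `b → e` that points upwards passes a crossing. -/
  | slideUp (k : CrossingKind) (a b c d e f p q r p' q' r' : L) :
      LocalMove {a, b, c, d, e, f}
        {.crossing .virt a b p q, .crossing k q c r f, .crossing .virt p r d e}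
        {.crossing .virt b c p' q', .crossing k a p' d r', .crossing .virt r' q' e f}
  /-- Moves v and vIII: a virtual strand `e → b` that points downwards passes a crossing. -/
  | slideDown (k : CrossingKind) (a b c d e f p q r p' q' r' : L) :
      LocalMove {a, b, c, d, e, f}
        {.crossing .virt q e r d, .crossing k p c q f, .crossing .virt r a p b}
        {.crossing .virt e q' f r', .crossing k a p' d q', .crossing .virt c r' b p'}

open Classical in
/-- One step between `X`-colored diagrams: a virtual Reidemeister move inside a disk, where the
colorings agree outside the disk, or one of the two changes of the code that leave the colored
diagram itself as it is. -/
inductive ColoredMove {X : Type*} [Biquandle X] {L : Type*} :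
    ColoredDiagram X L → ColoredDiagram X L → Prop
  /-- A Reidemeister move, `S` is the rest of the diagram. -/
  | reidemeister {K K' : ColoredDiagram X L} (P : Multiset L) (T T' S : DiagramCode L)
      (hT : LocalMove P T T') (hK : K.code = T + S) (hK' : K'.code = T' + S)
      (hP : ∀ e ∈ P, K'.color e = K.color e)
      (hS : ∀ e ∈ S.ins + S.outs, K'.color e = K.color e) : ColoredMove K K'
  /-- A marked point is put on the semiarc `e`, which becomes `e` followed by `e'`. -/
  | mark {K K' : ColoredDiagram X L} (e e' : L) (he : e ∈ K.code.outs)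
      (hK' : K'.code = .point e e' ::ₘ K.code.map (Vertex.mapIns (Function.update id e e')))
      (he' : K'.color e' = K.color e)
      (hc : ∀ a ∈ K.code.outs, K'.color a = K.color a) : ColoredMove K K'
  /-- The labels of the semiarcs are renamed. -/
  | relabel {K K' : ColoredDiagram X L} (σ : Equiv.Perm L)
      (hK' : K'.code = K.code.map (Vertex.map σ))
      (hc : ∀ a ∈ K.code.outs, K'.color (σ a) = K.color a) : ColoredMove K K'

/-!
Every move replaces one tangle by another, so it is enough to compare the contributions of the two
tangles for each fixed choice of smoothings in the rest of the diagram. Such a choice, together with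
a state of the tangle, gives a graph on the semiarcs, whose connected components are the closed
curves. A label inside the tangle can be eliminated from this graph: it is identified with a
neighbour, which does not change the number of components, or it is isolated and then stands for a
closed curve of its own (`numClasses_elimLabels`). What is left of a state of the tangle is the
number of closed curves that disappear and the way in which it joins the labels on the boundary.
Labels on the boundary may coincide in the diagram, but the elimination takes place among formal
labels (`IsTangle`, `Port`), of which only the inner ones must be sent to distinct semiarcs.

Hence the state sum is determined by the bracket of the tangle (`tangleBracket`), a sum over its
states with one unknown value for each way to join the boundary
(`ColoredDiagram.stateSum_eq_tangleBracket`), and a move leaves the state sum as it is if the two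
brackets, corrected by the writhe, have the same coefficient at every such unknown (`TangleMove`).
The coloring conditions relate the pairs of colors at the crossings on both sides, and the
coefficients then agree by the axioms of a biquandle virtual bracket: the equations `i_*` for
moves I, `ii_*` for moves II, and `iii_*`, one for each of the fifteen perfect matchings of six points,
for the classical move III (`tangleMove_braid`). When a virtual strand passes a crossing, the states on
both sides correspond to each other one by one.

Marking a semiarc adds a label that elimination removes again, and relabelling is a bijection
between the states.
-/

/-! ### Counting classes -/

/-- Two labels are linked if a chain of pairs of `r` whose members lie in `S` connects them. -/
def Linked {T : Type*} (S : Multiset T) (r : Multiset (T × T)) : T → T → Prop :=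
  Relation.EqvGen fun a b => a ∈ S ∧ b ∈ S ∧ (a, b) ∈ r

theorem Linked.of_mem {T : Type*} {S : Multiset T} {r : Multiset (T × T)} {a b : T}
    (ha : a ∈ S) (hb : b ∈ S) (h : (a, b) ∈ r) : Linked S r a b :=
  .rel _ _ ⟨ha, hb, h⟩

theorem Linked.quot_eq {T : Type*} {S : Multiset T} {r : Multiset (T × T)} {a b : T}
    (h : Linked S r a b) (ha : a ∈ S) (hb : b ∈ S) :
    Quot.mk (fun a b : {t : T // t ∈ S} => (a.1, b.1) ∈ r) ⟨a, ha⟩ = Quot.mk _ ⟨b, hb⟩ := by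
  -- The intermediate elements of a chain need not be known to lie in `S`, hence the alternative.
  have key : a = b ∨ ∃ (ha : a ∈ S) (hb : b ∈ S),
      Quot.mk (fun a b : {t : T // t ∈ S} => (a.1, b.1) ∈ r) ⟨a, ha⟩ = Quot.mk _ ⟨b, hb⟩ := by
    clear ha hb
    induction h with
    | rel x y h => exact .inr ⟨h.1, h.2.1, Quot.sound h.2.2⟩
    | refl x => exact .inl rfl
    | symm x y _ ih =>
      rcases ih with rfl | ⟨h1, h2, h3⟩
      · exact .inl rfl
      · exact .inr ⟨h2, h1, h3.symm⟩
    | trans x y z _ _ ih ih' =>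
      rcases ih with rfl | ⟨h1, h2, h3⟩
      · exact ih'
      · rcases ih' with rfl | ⟨h4, h5, h6⟩
        · exact .inr ⟨h1, h2, h3⟩
        · exact .inr ⟨h1, h5, h3.trans h6⟩
  rcases key with rfl | ⟨_, _, h⟩
  · rfl
  · exact h

/-- Mutually inverse maps up to links induce a bijection between the classes. -/
theorem numClasses_eq_of_maps {T T' : Type*} {S : Multiset T} {S' : Multiset T'}
    {r : Multiset (T × T)} {r' : Multiset (T' × T')} (φ : T → T') (ψ : T' → T)
    (hφ : ∀ a ∈ S, φ a ∈ S') (hψ : ∀ a ∈ S', ψ a ∈ S)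
    (hr : ∀ a ∈ S, ∀ b ∈ S, (a, b) ∈ r → Linked S' r' (φ a) (φ b))
    (hr' : ∀ a ∈ S', ∀ b ∈ S', (a, b) ∈ r' → Linked S r (ψ a) (ψ b))
    (hψφ : ∀ a ∈ S, Linked S r (ψ (φ a)) a) (hφψ : ∀ a ∈ S', Linked S' r' (φ (ψ a)) a) :
    numClasses S r = numClasses S' r' := by
  refine Nat.card_congr
    { toFun := Quot.lift (fun a => Quot.mk _ ⟨φ a.1, hφ _ a.2⟩) fun a b h =>
        (hr _ a.2 _ b.2 h).quot_eq _ _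
      invFun := Quot.lift (fun a => Quot.mk _ ⟨ψ a.1, hψ _ a.2⟩) fun a b h =>
        (hr' _ a.2 _ b.2 h).quot_eq _ _
      left_inv := ?_
      right_inv := ?_ }
  · rintro ⟨a⟩
    exact (hψφ _ a.2).quot_eq _ _
  · rintro ⟨a⟩
    exact (hφψ _ a.2).quot_eq _ _

theorem numClasses_congr {T : Type*} {S S' : Multiset T} {r r' : Multiset (T × T)}
    (hS : ∀ a, a ∈ S ↔ a ∈ S')
    (hr : ∀ a ∈ S, ∀ b ∈ S, (a, b) ∈ r → Linked S' r' a b)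
    (hr' : ∀ a ∈ S', ∀ b ∈ S', (a, b) ∈ r' → Linked S r a b) :
    numClasses S r = numClasses S' r' :=
  numClasses_eq_of_maps id id (fun a h => (hS a).1 h) (fun a h => (hS a).2 h) hr hr'
    (fun _ _ => .refl _) (fun _ _ => .refl _)

theorem numClasses_map_equiv {T : Type*} (σ : Equiv.Perm T) (S : Multiset T)
    (r : Multiset (T × T)) :
    numClasses (S.map σ) (r.map (Prod.map σ σ)) = numClasses S r := by
  have hmem : ∀ a, a ∈ S.map σ ↔ σ.symm a ∈ S := fun a => by
    rw [Multiset.mem_map]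
    exact ⟨by rintro ⟨b, hb, rfl⟩; simpa using hb, fun h => ⟨_, h, by simp⟩⟩
  symm
  refine numClasses_eq_of_maps σ σ.symm (fun a h => Multiset.mem_map_of_mem _ h)
    (fun a h => (hmem a).1 h) ?_ ?_ (fun a _ => ?_) (fun a _ => ?_)
  · intro a ha b hb h
    exact .of_mem (Multiset.mem_map_of_mem _ ha) (Multiset.mem_map_of_mem _ hb)
      (Multiset.mem_map_of_mem (Prod.map σ σ) h)
  · intro a ha b hb h
    obtain ⟨⟨c, d⟩, hcd, h⟩ := Multiset.mem_map.1 h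
    obtain ⟨rfl, rfl⟩ := Prod.mk.inj h
    exact .of_mem ((hmem _).1 ha) ((hmem _).1 hb) (by simpa using hcd)
  · rw [Equiv.symm_apply_apply]; exact .refl _
  · rw [Equiv.apply_symm_apply]; exact .refl _

/-- The map that sends `p` to `x` and leaves everything else as it is. -/
def collapse {T : Type*} [DecidableEq T] (p x : T) : T → T := fun u => if u = p then x else u

/-- A label `p` that is paired with another label `x` can be eliminated by identifying it
with `x`. -/
theorem numClasses_cons_collapse {T : Type*} [DecidableEq T] {S : Multiset T}
    {r : Multiset (T × T)} {p x : T} (hp : p ∉ S) (hx : x ∈ S)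
    (hr : (x, p) ∈ r ∨ (p, x) ∈ r) :
    numClasses (p ::ₘ S) r
      = numClasses S (r.map (Prod.map (collapse p x) (collapse p x))) := by
  have hxS : x ∈ p ::ₘ S := Multiset.mem_cons_of_mem hx
  have hxp : Linked (p ::ₘ S) r x p := by
    rcases hr with hr | hr
    · exact .of_mem hxS (Multiset.mem_cons_self _ _) hr
    · exact .symm _ _ (Linked.of_mem (Multiset.mem_cons_self _ _) hxS hr)
  have hc : ∀ a, Linked (p ::ₘ S) r (collapse p x a) a := fun a => by
    by_cases ha : a = p
    · simpa [collapse, ha] using hxp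
    · rw [collapse, if_neg ha]
      exact .refl a
  have hmem : ∀ a ∈ p ::ₘ S, collapse p x a ∈ S := fun a ha => by
    by_cases h : a = p
    · simpa [collapse, h] using hx
    · simpa [collapse, h] using ha
  have hcS : ∀ a, collapse p x a ∈ S → a ∈ p ::ₘ S := fun a ha => by
    by_cases h : a = p
    · simp [h]
    · exact Multiset.mem_cons_of_mem (by simpa [collapse, h] using ha)
  refine numClasses_eq_of_maps (collapse p x) id hmem (fun a h => Multiset.mem_cons_of_mem h)
    ?_ ?_ (fun a _ => hc a) (fun a ha => ?_)
  · intro a ha b hb h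
    exact .of_mem (hmem _ ha) (hmem _ hb) (Multiset.mem_map_of_mem (Prod.map _ _) h)
  · intro a ha b hb h
    obtain ⟨⟨c, d⟩, hcd, h⟩ := Multiset.mem_map.1 h
    obtain ⟨rfl, rfl⟩ := Prod.mk.inj h
    exact .trans _ _ _ (hc c)
      (.trans _ _ _ (Linked.of_mem (hcS _ ha) (hcS _ hb) hcd) (.symm _ _ (hc d)))
  · have : a ≠ p := fun h => hp (h ▸ ha)
    rw [id, collapse, if_neg this]
    exact .refl a

/-- A label that is paired with no other label is a class of its own. -/
theorem numClasses_cons_isolated {T : Type*} {S : Multiset T} {r : Multiset (T × T)} {p : T}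
    (hp : p ∉ S) (hr : ∀ a ∈ p ::ₘ S, ∀ b ∈ p ::ₘ S, (a, b) ∈ r → (a = p ↔ b = p)) :
    numClasses (p ::ₘ S) r = numClasses S r + 1 := by
  classical
  have hfin : Finite {t : T // t ∈ S} := S.finite_toSet
  have hmem : ∀ a : {t : T // t ∈ p ::ₘ S}, a.1 ≠ p → a.1 ∈ S := fun a h =>
    (Multiset.mem_cons.1 a.2).resolve_left h
  unfold numClasses
  rw [← Finite.card_option]
  refine Nat.card_congr
    { toFun := Quot.lift (fun a => if h : a.1 = p then none
        else some (Quot.mk _ ⟨a.1, hmem a h⟩)) fun a b h => ?_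
      invFun := fun o => o.elim (Quot.mk _ ⟨p, Multiset.mem_cons_self _ _⟩)
        (Quot.lift (fun a => Quot.mk _ ⟨a.1, Multiset.mem_cons_of_mem a.2⟩) fun a b h =>
          Quot.sound h)
      left_inv := ?_
      right_inv := ?_ }
  · have hab := hr _ a.2 _ b.2 h
    by_cases ha : a.1 = p
    · rw [dif_pos ha, dif_pos (hab.1 ha)]
    · rw [dif_neg ha, dif_neg fun hb => ha (hab.2 hb)]
      exact congrArg some (Quot.sound h)
  · rintro ⟨a⟩
    by_cases ha : a.1 = p
    · obtain ⟨a, h⟩ := a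
      obtain rfl : a = p := ha
      simp
    · simp [ha]
  · rintro (_ | ⟨⟨a⟩⟩)
    · simp
    · have : a.1 ≠ p := fun h => hp (h ▸ a.2)
      simp [this]

/-! ### Eliminating the inner labels of a state -/

section Elimination

variable {ι L : Type*} [DecidableEq ι]

/-- The other member of the pair `e`, if exactly one of its two members is `p`. -/
def otherEnd (p : ι) (e : ι × ι) : Option ι :=
  if e.1 = p then if e.2 = p then none else some e.2
  else if e.2 = p then some e.1 else none

/-- Eliminate the label `p` from a list of pairs: it is identified with a label it is paired with,
or else it is removed. The second component counts the closed curve that disappears in the latter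
case. -/
def elimLabel (p : ι) (l : List (ι × ι)) : List (ι × ι) × ℕ :=
  match l.findSome? (otherEnd p) with
  | some x => (l.map (Prod.map (collapse p x) (collapse p x)), 0)
  | none => (l.filter fun e => e.1 ≠ p ∧ e.2 ≠ p, 1)

/-- Eliminate several labels one after the other and count the closed curves that disappear. -/
def elimLabels : List ι → List (ι × ι) → List (ι × ι) × ℕ
  | [], l => (l, 0)
  | p :: ps, l => ((elimLabels ps (elimLabel p l).1).1,
      (elimLabel p l).2 + (elimLabels ps (elimLabel p l).1).2)

/-- The pairs of different labels in `B` that occur in `l` in one of the two orders, listed in a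
canonical order: two lists of pairs that join the labels of `B` in the same way get the same
canonical list. -/
def canonicalPairs : List ι → List (ι × ι) → List (ι × ι)
  | [], _ => []
  | b :: B, l => ((B.filter fun c => (b, c) ∈ l ∨ (c, b) ∈ l).map fun c => (b, c))
      ++ canonicalPairs B l

theorem eq_of_otherEnd {p x : ι} {e : ι × ι} (h : otherEnd p e = some x) :
    x ≠ p ∧ (e = (x, p) ∨ e = (p, x)) := by
  obtain ⟨u, v⟩ := e
  unfold otherEnd at h
  split_ifs at h <;> aesop

theorem iff_of_otherEnd {p : ι} {e : ι × ι} (h : otherEnd p e = none) : e.1 = p ↔ e.2 = p := by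
  unfold otherEnd at h
  split_ifs at h <;> simp_all

theorem mem_canonicalPairs {B : List ι} {l : List (ι × ι)} {u v : ι}
    (h : (u, v) ∈ canonicalPairs B l) : (u, v) ∈ l ∨ (v, u) ∈ l := by
  induction B with
  | nil => simp [canonicalPairs] at h
  | cons b B ih =>
    simp only [canonicalPairs, List.mem_append, List.mem_map, List.mem_filter,
      decide_eq_true_eq] at h
    rcases h with ⟨c, ⟨_, hc⟩, h⟩ | h
    · obtain ⟨rfl, rfl⟩ := Prod.mk.inj h
      exact hc
    · exact ih h

theorem canonicalPairs_complete {B : List ι} {l : List (ι × ι)} {u v : ι} (h : (u, v) ∈ l)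
    (hu : u ∈ B) (hv : v ∈ B) (huv : u ≠ v) :
    (u, v) ∈ canonicalPairs B l ∨ (v, u) ∈ canonicalPairs B l := by
  induction B with
  | nil => simp at hu
  | cons b B ih =>
    simp only [canonicalPairs, List.mem_append, List.mem_map, List.mem_filter,
      decide_eq_true_eq]
    rcases List.mem_cons.1 hu with rfl | hu'
    · have hv : v ∈ B := (List.mem_cons.1 hv).resolve_left huv.symm
      exact .inl (.inl ⟨v, ⟨hv, .inl h⟩, rfl⟩)
    · rcases List.mem_cons.1 hv with rfl | hv
      · exact .inr (.inl ⟨u, ⟨hu', .inr h⟩, rfl⟩)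
      · exact (ih hu' hv).imp .inr .inr

/-- Elimination of the inner labels does not change the number of classes, up to the closed curves
that it counts. The labels of `I` are the inner ones, those of `B` lie on the boundary, and `g`
sends them to the labels of a diagram, where labels of `B` may coincide. The pairs `r` outside must
not involve the inner labels. -/
theorem numClasses_elimLabels (g : ι → L) (B : List ι) (O : Multiset L) (r : Multiset (L × L))
    (I : List ι) (l : List (ι × ι)) (hI : I.Nodup)
    (hB : ∀ b ∈ B, g b ∈ O)
    (hl : ∀ e ∈ l, (e.1 ∈ I ∨ e.1 ∈ B) ∧ (e.2 ∈ I ∨ e.2 ∈ B))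
    (hg : ∀ p ∈ I, ∀ q, q ∈ I ∨ q ∈ B → q ≠ p → g q ≠ g p)
    (hO : ∀ p ∈ I, g p ∉ O) (hr : ∀ p ∈ I, ∀ e ∈ r, e.1 ≠ g p ∧ e.2 ≠ g p) :
    numClasses ((I : Multiset ι).map g + O) ((l : Multiset (ι × ι)).map (Prod.map g g) + r)
        = numClasses O (((elimLabels I l).1 : Multiset (ι × ι)).map (Prod.map g g) + r)
          + (elimLabels I l).2 ∧
      ∀ e ∈ (elimLabels I l).1, e.1 ∈ B ∧ e.2 ∈ B := by
  classical
  induction I generalizing l with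
  | nil => simpa [elimLabels] using hl
  | cons p I ih =>
    obtain ⟨hpI, hI⟩ := List.nodup_cons.1 hI
    have hpS : g p ∉ ((I : Multiset ι).map g + O) := by
      rw [Multiset.mem_add, Multiset.mem_map]
      rintro (⟨q, hq, hqp⟩ | h)
      · exact hg p List.mem_cons_self q (.inl (List.mem_cons_of_mem _ hq))
          (fun h => hpI (h ▸ hq)) hqp
      · exact hO p List.mem_cons_self h
    have hS : (((p :: I : List ι) : Multiset ι).map g + O)
        = g p ::ₘ ((I : Multiset ι).map g + O) := by
      rw [← Multiset.cons_coe, Multiset.map_cons, Multiset.cons_add]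
    have hgS : ∀ x, x ∈ p :: I ∨ x ∈ B → x ≠ p → g x ∈ ((I : Multiset ι).map g + O) := by
      intro x hx hxp
      rw [Multiset.mem_add]
      rcases hx with hx | hx
      · exact .inl (Multiset.mem_map_of_mem _ ((List.mem_cons.1 hx).resolve_left hxp))
      · exact .inr (hB x hx)
    -- It is enough to eliminate the first label.
    have step : numClasses (((p :: I : List ι) : Multiset ι).map g + O)
          ((l : Multiset (ι × ι)).map (Prod.map g g) + r)
        = numClasses ((I : Multiset ι).map g + O)
          (((elimLabel p l).1 : Multiset (ι × ι)).map (Prod.map g g) + r)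
          + (elimLabel p l).2 ∧
        ∀ e ∈ (elimLabel p l).1, (e.1 ∈ I ∨ e.1 ∈ B) ∧ (e.2 ∈ I ∨ e.2 ∈ B) := by
      rw [hS]
      unfold elimLabel
      split
      · rename_i x hx
        obtain ⟨e, he, hex⟩ := List.exists_of_findSome?_eq_some hx
        obtain ⟨hxp, hex⟩ := eq_of_otherEnd hex
        have hxm : x ∈ p :: I ∨ x ∈ B := by
          rcases hex with rfl | rfl
          · exact (hl _ he).1
          · exact (hl _ he).2
        refine ⟨?_, ?_⟩
        · rw [numClasses_cons_collapse hpS (hgS x hxm hxp), add_zero, Multiset.map_add]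
          · congr 2
            · rw [Multiset.map_map, ← Multiset.map_coe, Multiset.map_map]
              refine Multiset.map_congr rfl fun e he => ?_
              have hc : ∀ u, u ∈ p :: I ∨ u ∈ B →
                  collapse (g p) (g x) (g u) = g (collapse p x u) := fun u hu => by
                by_cases hup : u = p
                · simp [collapse, hup]
                · simp [collapse, hup, hg p List.mem_cons_self u hu hup]
              exact Prod.ext (hc _ (hl e he).1) (hc _ (hl e he).2)
            · refine (Multiset.map_congr rfl fun e he => ?_).trans r.map_id
              have := hr p List.mem_cons_self e he
              exact Prod.ext (if_neg this.1) (if_neg this.2)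
          · simp only [Multiset.mem_add, Multiset.mem_map]
            rcases hex with rfl | rfl
            · exact .inl (.inl ⟨_, he, rfl⟩)
            · exact .inr (.inl ⟨_, he, rfl⟩)
        · intro e he
          obtain ⟨e, hel, rfl⟩ := List.mem_map.1 he
          have hc : ∀ u, u ∈ p :: I ∨ u ∈ B → collapse p x u ∈ I ∨ collapse p x u ∈ B := by
            intro u hu
            by_cases hup : u = p
            · simpa [collapse, hup, hxp] using hxm
            · simpa [collapse, hup] using hu
          exact ⟨hc _ (hl e hel).1, hc _ (hl e hel).2⟩
      · rename_i hx
        have hiff : ∀ e ∈ l, e.1 = p ↔ e.2 = p := fun e he =>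
          iff_of_otherEnd (List.findSome?_eq_none_iff.1 hx e he)
        have hne : ∀ u, u ∈ p :: I ∨ u ∈ B → (g u = g p ↔ u = p) := fun u hu =>
          ⟨fun h => by_contra fun hup => hg p List.mem_cons_self u hu hup h, fun h => by rw [h]⟩
        refine ⟨?_, ?_⟩
        · rw [numClasses_cons_isolated hpS]
          · congr 1
            refine numClasses_congr (fun _ => Iff.rfl) ?_ ?_
            · intro a ha b hb hab
              refine .of_mem ha hb ?_
              rw [Multiset.mem_add] at hab ⊢
              refine hab.imp_left fun h => ?_
              rw [Multiset.mem_map] at h ⊢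
              obtain ⟨e, he, h⟩ := h
              refine ⟨e, List.mem_filter.2 ⟨he, ?_⟩, h⟩
              obtain ⟨rfl, rfl⟩ := Prod.mk.inj h
              exact decide_eq_true ⟨fun h => hpS (h ▸ ha), fun h => hpS (h ▸ hb)⟩
            · intro a ha b hb hab
              refine .of_mem ha hb ?_
              rw [Multiset.mem_add] at hab ⊢
              refine hab.imp_left fun h => ?_
              rw [Multiset.mem_map] at h ⊢
              obtain ⟨e, he, h⟩ := h
              exact ⟨e, (List.mem_filter.1 he).1, h⟩
          · intro a _ b _ hab
            rw [Multiset.mem_add] at hab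
            rcases hab with hab | hab
            · rw [Multiset.mem_map] at hab
              obtain ⟨e, he, h⟩ := hab
              obtain ⟨rfl, rfl⟩ := Prod.mk.inj h
              rw [hne _ (hl e he).1, hne _ (hl e he).2, hiff e he]
            · have := hr p List.mem_cons_self _ hab
              exact iff_of_false this.1 this.2
        · intro e he
          obtain ⟨he, hep⟩ := List.mem_filter.1 he
          have hep := of_decide_eq_true hep
          have := hl e he
          simp only [List.mem_cons, hep.1, hep.2, false_or] at this
          exact this
    obtain ⟨ih1, ih2⟩ := ih (elimLabel p l).1 hI step.2
      (fun q hq u hu => hg q (List.mem_cons_of_mem _ hq) u (hu.imp_left (List.mem_cons_of_mem _)))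
      (fun q hq => hO q (List.mem_cons_of_mem _ hq))
      (fun q hq => hr q (List.mem_cons_of_mem _ hq))
    refine ⟨?_, ih2⟩
    rw [step.1, ih1]
    simp only [elimLabels]
    omega

/-- The number of classes depends only on how the boundary labels are joined, not on the list of
pairs that expresses it. -/
theorem numClasses_canonicalPairs (g : ι → L) (B : List ι) (O : Multiset L)
    (r : Multiset (L × L)) (l : List (ι × ι)) (hl : ∀ e ∈ l, e.1 ∈ B ∧ e.2 ∈ B) :
    numClasses O ((l : Multiset (ι × ι)).map (Prod.map g g) + r)
      = numClasses O (((canonicalPairs B l) : Multiset (ι × ι)).map (Prod.map g g) + r) := by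
  refine numClasses_congr (fun _ => Iff.rfl) ?_ ?_
  · intro a ha b hb hab
    rw [Multiset.mem_add, Multiset.mem_map] at hab
    rcases hab with ⟨⟨u, v⟩, he, h⟩ | hab
    · obtain ⟨rfl, rfl⟩ := Prod.mk.inj h
      by_cases huv : u = v
      · rw [huv]
        exact .refl _
      · rcases canonicalPairs_complete he (hl _ he).1 (hl _ he).2 huv with h | h
        · exact .of_mem ha hb (Multiset.mem_add.2 (.inl (Multiset.mem_map.2 ⟨_, h, rfl⟩)))
        · exact .symm _ _ (Linked.of_mem hb ha
          (Multiset.mem_add.2 (.inl (Multiset.mem_map.2 ⟨_, h, rfl⟩))))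
    · exact .of_mem ha hb (Multiset.mem_add.2 (.inr hab))
  · intro a ha b hb hab
    rw [Multiset.mem_add, Multiset.mem_map] at hab
    rcases hab with ⟨⟨u, v⟩, he, h⟩ | hab
    · obtain ⟨rfl, rfl⟩ := Prod.mk.inj h
      rcases mem_canonicalPairs he with h | h
      · exact .of_mem ha hb (Multiset.mem_add.2 (.inl (Multiset.mem_map.2 ⟨_, h, rfl⟩)))
      · exact .symm _ _ (Linked.of_mem hb ha
          (Multiset.mem_add.2 (.inl (Multiset.mem_map.2 ⟨_, h, rfl⟩))))
    · exact .of_mem ha hb (Multiset.mem_add.2 (.inr hab))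

end Elimination

/-! ### State sums over parts of a diagram -/

section SectionSum

variable {R L : Type*} [CommRing R]

/-- The sum over all choices of one smoothing at every vertex, `M` being the multiset of the
smoothings available at the vertices: the product of the coefficients times the value of `Φ` at the
pairs that the chosen smoothings join. -/
def sectionSum (M : Multiset (Multiset (R × Multiset (L × L)))) (Φ : Multiset (L × L) → R) : R :=
  (M.Sections.map fun S => (S.map Prod.fst).prod * Φ (S.bind Prod.snd)).sum

theorem sectionSum_zero (Φ : Multiset (L × L) → R) :
    sectionSum (0 : Multiset (Multiset (R × Multiset (L × L)))) Φ = Φ 0 := by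
  simp [sectionSum]

theorem sectionSum_cons (s : Multiset (R × Multiset (L × L)))
    (M : Multiset (Multiset (R × Multiset (L × L)))) (Φ : Multiset (L × L) → R) :
    sectionSum (s ::ₘ M) Φ
      = (s.map fun c => c.1 * sectionSum M fun l => Φ (c.2 + l)).sum := by
  simp only [sectionSum, Multiset.sections_cons, Multiset.map_bind, Multiset.sum_bind,
    Multiset.map_map, Function.comp_def, Multiset.map_cons, Multiset.prod_cons,
    Multiset.cons_bind, mul_assoc, Multiset.sum_map_mul_left]

theorem sectionSum_add (M N : Multiset (Multiset (R × Multiset (L × L))))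
    (Φ : Multiset (L × L) → R) :
    sectionSum (M + N) Φ = sectionSum N fun l' => sectionSum M fun l => Φ (l + l') := by
  induction N using Multiset.induction generalizing Φ with
  | empty => simp [sectionSum_zero]
  | cons s N ih =>
    rw [Multiset.add_cons, sectionSum_cons, sectionSum_cons]
    refine congrArg Multiset.sum (Multiset.map_congr rfl fun c _ => ?_)
    rw [ih]
    simp only [add_left_comm c.2]

/-- Only the values of `Φ` at pairs that smoothings join matter. -/
theorem sectionSum_congr {M : Multiset (Multiset (R × Multiset (L × L)))}
    {Φ Ψ : Multiset (L × L) → R} (Q : L × L → Prop) (hM : ∀ s ∈ M, ∀ c ∈ s, ∀ e ∈ c.2, Q e)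
    (h : ∀ l : Multiset (L × L), (∀ e ∈ l, Q e) → Φ l = Ψ l) :
    sectionSum M Φ = sectionSum M Ψ := by
  induction M using Multiset.induction generalizing Φ Ψ with
  | empty => simp [sectionSum_zero, h 0]
  | cons s M ih =>
    rw [sectionSum_cons, sectionSum_cons]
    refine congrArg Multiset.sum (Multiset.map_congr rfl fun c hc => congrArg _ (ih ?_ ?_))
    · exact fun s hs => hM s (Multiset.mem_cons_of_mem hs)
    · intro l hl
      refine h _ fun e he => ?_
      rcases Multiset.mem_add.1 he with he | he
      · exact hM s (Multiset.mem_cons_self _ _) c hc e he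
      · exact hl e he

theorem sectionSum_mul_right (M : Multiset (Multiset (R × Multiset (L × L))))
    (Φ : Multiset (L × L) → R) (a : R) :
    sectionSum M Φ * a = sectionSum M fun l => Φ l * a := by
  simp only [sectionSum, ← Multiset.sum_map_mul_right, mul_assoc]

/-- Renaming the labels in all smoothings. -/
theorem sectionSum_map {L' : Type*} (ρ : L → L') (M : Multiset (Multiset (R × Multiset (L × L))))
    (Φ : Multiset (L' × L') → R) :
    sectionSum (M.map (Multiset.map (Prod.map id (Multiset.map (Prod.map ρ ρ))))) Φ
      = sectionSum M fun l => Φ (l.map (Prod.map ρ ρ)) := by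
  induction M using Multiset.induction generalizing Φ with
  | empty => simp [sectionSum_zero]
  | cons s M ih =>
    simp only [Multiset.map_cons, sectionSum_cons, Multiset.map_map, Function.comp_def, ih,
      Prod.map_fst, Prod.map_snd, id, Multiset.map_add]

end SectionSum

section Diagrams

variable {X : Type*} [Biquandle X] {R : Type*} [CommRing R] {L : Type*}

theorem ColoredDiagram.stateSum_eq_sectionSum (K : ColoredDiagram X L)
    (β : BiquandleVirtualBracket X R) :
    K.stateSum β = sectionSum (K.code.map (Vertex.smoothings β K.color))
      (fun l => β.δ ^ numClasses K.code.outs l) * K.writheFactor β := by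
  rw [sectionSum_mul_right]
  simp only [stateSum, sectionSum, states, ← mul_assoc]
  rfl

namespace Vertex

/-- The smoothings of a vertex join semiarcs at this vertex. -/
theorem mem_of_mem_smoothings (β : BiquandleVirtualBracket X R) (f : L → X) {v : Vertex L}
    {c : R × Multiset (L × L)} (hc : c ∈ v.smoothings β f) {e : L × L} (he : e ∈ c.2) :
    e.1 ∈ v.ins + v.outs ∧ e.2 ∈ v.ins + v.outs := by
  rcases v with ⟨_ | _ | _, bl, br, tl, tr⟩ | ⟨s, t⟩ <;>
    simp only [smoothings, Multiset.insert_eq_cons, Multiset.mem_cons,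
      Multiset.mem_singleton] at hc
  · rcases hc with rfl | rfl | rfl <;> simp at he <;> rcases he with rfl | rfl <;>
      simp [ins, outs]
  · rcases hc with rfl | rfl | rfl <;> simp at he <;> rcases he with rfl | rfl <;>
      simp [ins, outs]
  · subst hc
    simp at he
    rcases he with rfl | rfl <;> simp [ins, outs]
  · subst hc
    simp at he
    subst he
    simp [ins, outs]

theorem smoothings_congr (β : BiquandleVirtualBracket X R) {f f' : L → X} {v : Vertex L}
    (h : ∀ e ∈ v.ins + v.outs, f' e = f e) : v.smoothings β f' = v.smoothings β f := by
  rcases v with ⟨_ | _ | _, bl, br, tl, tr⟩ | ⟨s, t⟩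
  · simp only [smoothings, h br (by simp [ins]), h tr (by simp [outs])]
  · simp only [smoothings, h br (by simp [ins]), h tr (by simp [outs])]
  · rfl
  · rfl

theorem smoothings_map {L' : Type*} (β : BiquandleVirtualBracket X R) (g : L → L') (f : L' → X)
    (v : Vertex L) : (v.map g).smoothings β f
      = (v.smoothings β (f ∘ g)).map (Prod.map id (Multiset.map (Prod.map g g))) := by
  rcases v with ⟨_ | _ | _, bl, br, tl, tr⟩ | ⟨s, t⟩ <;> simp [smoothings, map]

end Vertex

theorem DiagramCode.ins_add (D E : DiagramCode L) : (D + E).ins = D.ins + E.ins :=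
  Multiset.add_bind _ _ _

theorem DiagramCode.outs_add (D E : DiagramCode L) : (D + E).outs = D.outs + E.outs :=
  Multiset.add_bind _ _ _

theorem DiagramCode.numCrossings_add (k : CrossingKind) (D E : DiagramCode L) :
    (D + E).numCrossings k = D.numCrossings k + E.numCrossings k :=
  Multiset.countP_add _ _ _

/-- The writhe correction of a part of a diagram. -/
def DiagramCode.writheUnit (D : DiagramCode L) (β : BiquandleVirtualBracket X R) : Rˣ :=
  β.w ^ ((D.numCrossings .neg : ℤ) - (D.numCrossings .pos : ℤ))

theorem DiagramCode.writheUnit_add (D E : DiagramCode L) (β : BiquandleVirtualBracket X R) :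
    (D + E).writheUnit β = D.writheUnit β * E.writheUnit β := by
  rw [writheUnit, writheUnit, writheUnit, ← zpow_add, numCrossings_add, numCrossings_add]
  congr 1
  push_cast
  ring

/-! ### Marking and relabelling -/

theorem Vertex.isCrossing_map {L' : Type*} (k : CrossingKind) (g : L → L') (v : Vertex L) :
    (v.map g).IsCrossing k ↔ v.IsCrossing k := by
  cases v <;> rfl

theorem Vertex.isCrossing_mapIns (k : CrossingKind) (g : L → L) (v : Vertex L) :
    (v.mapIns g).IsCrossing k ↔ v.IsCrossing k := by
  cases v <;> rfl

theorem Vertex.outs_map {L' : Type*} (g : L → L') (v : Vertex L) :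
    (v.map g).outs = v.outs.map g := by
  cases v <;> simp [outs, map]

theorem Vertex.ins_map {L' : Type*} (g : L → L') (v : Vertex L) :
    (v.map g).ins = v.ins.map g := by
  cases v <;> simp [ins, map]

theorem DiagramCode.outs_map {L' : Type*} (g : L → L') (D : DiagramCode L) :
    DiagramCode.outs (Multiset.map (Vertex.map g) D) = D.outs.map g := by
  simp only [outs, Multiset.bind_map, Multiset.map_bind, Vertex.outs_map]

theorem DiagramCode.ins_map {L' : Type*} (g : L → L') (D : DiagramCode L) :
    DiagramCode.ins (Multiset.map (Vertex.map g) D) = D.ins.map g := by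
  simp only [ins, Multiset.bind_map, Multiset.map_bind, Vertex.ins_map]

theorem DiagramCode.numCrossings_map {L' : Type*} (k : CrossingKind) {φ : Vertex L → Vertex L'}
    (hφ : ∀ v, (φ v).IsCrossing k ↔ v.IsCrossing k) (D : DiagramCode L) :
    DiagramCode.numCrossings k (Multiset.map φ D) = D.numCrossings k := by
  rw [numCrossings, numCrossings, Multiset.countP_map, Multiset.countP_eq_card_filter]
  exact congrArg _ (Multiset.filter_congr fun v _ => hφ v)

theorem ColoredDiagram.mem_outs_of_mem (K : ColoredDiagram X L) {v : Vertex L} (hv : v ∈ K.code)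
    {e : L} (he : e ∈ v.ins + v.outs) : e ∈ K.code.outs := by
  rcases Multiset.mem_add.1 he with he | he
  · rw [← K.closed]
    exact Multiset.mem_bind.2 ⟨v, hv, he⟩
  · exact Multiset.mem_bind.2 ⟨v, hv, he⟩

theorem ColoredDiagram.stateSum_relabel (β : BiquandleVirtualBracket X R)
    {K K' : ColoredDiagram X L} (σ : Equiv.Perm L)
    (hK' : K'.code = K.code.map (Vertex.map σ))
    (hc : ∀ a ∈ K.code.outs, K'.color (σ a) = K.color a) : K'.stateSum β = K.stateSum β := by
  have hsm : K'.code.map (Vertex.smoothings β K'.color)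
      = (K.code.map (Vertex.smoothings β K.color)).map
        (Multiset.map (Prod.map id (Multiset.map (Prod.map σ σ)))) := by
    rw [hK', Multiset.map_map, Multiset.map_map]
    refine Multiset.map_congr rfl fun v hv => ?_
    rw [Function.comp_apply, Vertex.smoothings_map, Function.comp_apply]
    exact congrArg _ (Vertex.smoothings_congr β fun e he => hc e (K.mem_outs_of_mem hv he))
  rw [stateSum_eq_sectionSum, stateSum_eq_sectionSum, hsm, sectionSum_map, hK',
    DiagramCode.outs_map]
  simp only [numClasses_map_equiv, writheFactor, hK',
    DiagramCode.numCrossings_map _ (Vertex.isCrossing_map _ _)]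

/-- Identifying the new piece `e'` of a marked semiarc with the old piece `e` takes the smoothings
back to those before the mark. -/
theorem Vertex.smoothings_mapIns [DecidableEq L] (β : BiquandleVirtualBracket X R) {f f' : L → X}
    {e e' : L} {v : Vertex L} (hv : e' ∉ v.ins + v.outs) (he : f' e' = f e)
    (hf : ∀ a ∈ v.ins + v.outs, f' a = f a) :
    ((v.mapIns (Function.update id e e')).smoothings β f').map
        (Prod.map id (Multiset.map (Prod.map (collapse e' e) (collapse e' e))))
      = v.smoothings β f := by
  have h1 : ∀ a ∈ v.ins + v.outs, collapse e' e a = a := fun a ha =>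
    if_neg fun h : a = e' => hv (h ▸ ha)
  have h2 : ∀ a ∈ v.ins + v.outs, collapse e' e (Function.update id e e' a) = a := fun a ha => by
    by_cases h : a = e
    · simp [h, collapse]
    · simp [h, h1 a ha]
  have h3 : ∀ a ∈ v.ins + v.outs, f' (Function.update id e e' a) = f a := fun a ha => by
    by_cases h : a = e
    · simp [h, he]
    · simp [h, hf a ha]
  rcases v with ⟨_ | _ | _, bl, br, tl, tr⟩ | ⟨s, t⟩ <;>
    simp_all [smoothings, mapIns, ins, outs]

theorem ColoredDiagram.stateSum_mark [DecidableEq L] (β : BiquandleVirtualBracket X R)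
    {K K' : ColoredDiagram X L} (e e' : L) (he : e ∈ K.code.outs)
    (hK' : K'.code = .point e e' ::ₘ K.code.map (Vertex.mapIns (Function.update id e e')))
    (he' : K'.color e' = K.color e) (hc : ∀ a ∈ K.code.outs, K'.color a = K.color a) :
    K'.stateSum β = K.stateSum β := by
  have houts : K'.code.outs = e' ::ₘ K.code.outs := by
    have : ∀ v : Vertex L, (v.mapIns (Function.update id e e')).outs = v.outs := fun v => by
      cases v <;> rfl
    rw [hK', DiagramCode.outs, Multiset.cons_bind, Multiset.bind_map]
    simp only [this]
    rfl
  have hfresh : e' ∉ K.code.outs := by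
    have := K'.nodup
    rw [houts] at this
    exact (Multiset.nodup_cons.1 this).1
  have hw : K'.writheFactor β = K.writheFactor β := by
    have : ∀ k, K'.code.numCrossings k = K.code.numCrossings k := fun k => by
      rw [← DiagramCode.numCrossings_map k
        (Vertex.isCrossing_mapIns k (Function.update id e e')) K.code, hK']
      exact Multiset.countP_cons_of_neg _ id
    simp only [writheFactor, this]
  have hsm : K.code.map (Vertex.smoothings β K.color)
      = (K.code.map fun v => (v.mapIns (Function.update id e e')).smoothings β K'.color).map
        (Multiset.map
          (Prod.map id (Multiset.map (Prod.map (collapse e' e) (collapse e' e))))) := by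
    rw [Multiset.map_map]
    refine Multiset.map_congr rfl fun v hv => (Vertex.smoothings_mapIns β ?_ he' ?_).symm
    · exact fun h => hfresh (K.mem_outs_of_mem hv h)
    · exact fun a ha => hc a (K.mem_outs_of_mem hv ha)
  rw [stateSum_eq_sectionSum, stateSum_eq_sectionSum, hw, hsm, sectionSum_map, hK',
    Multiset.map_cons, sectionSum_cons, Multiset.map_map, ← hK', houts]
  simp only [Vertex.smoothings, Multiset.map_singleton, Multiset.sum_singleton, one_mul]
  congr 2
  funext l
  have hee : collapse e' e e = e := if_neg fun h : e = e' => hfresh (h ▸ he)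
  rw [numClasses_cons_collapse hfresh he (.inl (by simp)), Multiset.map_add,
    Multiset.map_singleton]
  congr 1
  -- The pair `(e, e')` becomes the pair `(e, e)`, which has no effect.
  refine numClasses_congr (fun _ => Iff.rfl) ?_ ?_
  · intro a ha b hb h
    rcases Multiset.mem_add.1 h with h | h
    · rw [Multiset.mem_singleton, Prod.map_apply, hee, collapse, if_pos rfl] at h
      obtain ⟨rfl, rfl⟩ := Prod.mk.inj h
      exact .refl _
    · exact .of_mem ha hb h
  · exact fun a ha b hb h => .of_mem ha hb (Multiset.mem_add.2 (.inr h))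

end Diagrams

/-! ### Replacing a tangle -/

section Tangles

variable {X : Type*} [Biquandle X] {R : Type*} [CommRing R] {ι L : Type*}

/-- `Vertex.smoothings` with lists in place of multisets. -/
def Vertex.smoothingList (β : BiquandleVirtualBracket X R) (f : ι → X) :
    Vertex ι → List (R × List (ι × ι))
  | crossing .pos bl br tl tr =>
      [(β.A (f br) (f tr), [(bl, tl), (br, tr)]), (β.B (f br) (f tr), [(bl, br), (tl, tr)]),
        (β.V (f br) (f tr), [(bl, tr), (br, tl)])]
  | crossing .neg bl br tl tr =>
      [(β.C (f tr) (f br), [(bl, tl), (br, tr)]), (β.D (f tr) (f br), [(bl, br), (tl, tr)]),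
        (β.U (f tr) (f br), [(bl, tr), (br, tl)])]
  | crossing .virt bl br tl tr => [(1, [(bl, tr), (br, tl)])]
  | point s t => [(1, [(s, t)])]

/-- The states of a tangle, each with its coefficient and with the pairs that it joins. -/
def tangleStates (β : BiquandleVirtualBracket X R) (f : ι → X) :
    List (Vertex ι) → List (R × List (ι × ι))
  | [] => [(1, [])]
  | v :: T => (v.smoothingList β f).flatMap fun c =>
      (tangleStates β f T).map fun d => (c.1 * d.1, c.2 ++ d.2)

/-- The bracket of a tangle `T` with inner labels `I` and boundary labels `B`: the sum over its
states of the coefficient times `δ` for every closed curve times the value of `ev` at the way in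
which the state joins the boundary. -/
def tangleBracket [DecidableEq ι] (β : BiquandleVirtualBracket X R) (f : ι → X) (I B : List ι)
    (T : List (Vertex ι)) (ev : List (ι × ι) → R) : R :=
  ((tangleStates β f T).map fun c =>
    c.1 * (β.δ ^ (elimLabels I c.2).2 * ev (canonicalPairs B (elimLabels I c.2).1))).sum

/-- `T` is a tangle with inner labels `I` and boundary labels `B`: an inner label belongs to a
semiarc that begins and ends in `T`, a boundary label to a semiarc that at least begins or ends
there. -/
structure IsTangle (T : List (Vertex ι)) (I B : List ι) : Prop where
  nodup : I.Nodup
  disjoint : ∀ i ∈ I, i ∉ B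
  ins_sub : ∀ i ∈ DiagramCode.ins (T : DiagramCode ι), i ∈ I ∨ i ∈ B
  outs_sub : ∀ i ∈ DiagramCode.outs (T : DiagramCode ι), i ∈ I ∨ i ∈ B
  inner_ins : ∀ i ∈ I, i ∈ DiagramCode.ins (T : DiagramCode ι)
  inner_outs : ∀ i ∈ I, i ∈ DiagramCode.outs (T : DiagramCode ι)
  boundary : ∀ b ∈ B, b ∈ DiagramCode.ins (T : DiagramCode ι) ∨
    b ∈ DiagramCode.outs (T : DiagramCode ι)

theorem Vertex.smoothings_eq_smoothingList (β : BiquandleVirtualBracket X R) (f : ι → X)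
    (v : Vertex ι) : v.smoothings β f
      = ((v.smoothingList β f).map (Prod.map id ((↑) : List (ι × ι) → Multiset (ι × ι))) :
        List _) := by
  rcases v with ⟨_ | _ | _, bl, br, tl, tr⟩ | ⟨s, t⟩ <;> rfl

theorem sectionSum_tangle (β : BiquandleVirtualBracket X R) (f : ι → X) (T : List (Vertex ι))
    (Φ : Multiset (ι × ι) → R) :
    sectionSum ((T : Multiset (Vertex ι)).map (Vertex.smoothings β f)) Φ
      = ((tangleStates β f T).map fun c => c.1 * Φ c.2).sum := by
  induction T generalizing Φ with
  | nil => simp [tangleStates, sectionSum_zero]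
  | cons v T ih =>
    rw [← Multiset.cons_coe, Multiset.map_cons, sectionSum_cons,
      Vertex.smoothings_eq_smoothingList, tangleStates]
    simp only [ih]
    simp only [Multiset.map_coe, Multiset.sum_coe, List.map_map, List.flatMap_def,
      List.map_flatten, List.sum_flatten, Function.comp_def, Prod.map_fst, Prod.map_snd, id,
      Multiset.coe_add, mul_assoc, List.sum_map_mul_left]

/-- The pairs that a state of a tangle joins consist of labels of the tangle. -/
theorem mem_of_mem_tangleStates (β : BiquandleVirtualBracket X R) (f : ι → X)
    {T : List (Vertex ι)} {c : R × List (ι × ι)} (hc : c ∈ tangleStates β f T) {e : ι × ι}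
    (he : e ∈ c.2) : ∃ v ∈ T, e.1 ∈ v.ins + v.outs ∧ e.2 ∈ v.ins + v.outs := by
  induction T generalizing c with
  | nil =>
    obtain rfl : c = (1, []) := by simpa [tangleStates] using hc
    simp at he
  | cons v T ih =>
    obtain ⟨a, ha, hc⟩ := List.mem_flatMap.1 hc
    obtain ⟨d, hd, rfl⟩ := List.mem_map.1 hc
    rcases List.mem_append.1 he with he | he
    · have ha : (a.1, (a.2 : Multiset (ι × ι))) ∈ v.smoothings β f := by
        rw [Vertex.smoothings_eq_smoothingList, Multiset.mem_coe]
        exact List.mem_map.2 ⟨a, ha, rfl⟩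
      exact ⟨v, List.mem_cons_self, Vertex.mem_of_mem_smoothings β f ha he⟩
    · obtain ⟨u, hu, h⟩ := ih hd he
      exact ⟨u, List.mem_cons_of_mem _ hu, h⟩

/-- The state sum of a diagram that contains a tangle is a sum over the states of the rest of the
diagram of brackets of the tangle. -/
theorem ColoredDiagram.stateSum_eq_tangleBracket [DecidableEq ι]
    (β : BiquandleVirtualBracket X R) (K : ColoredDiagram X L) (g : ι → L) {T : List (Vertex ι)}
    {I B : List ι} (hT : IsTangle T I B) (S : DiagramCode L)
    (hK : K.code = (T : Multiset (Vertex ι)).map (Vertex.map g) + S) :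
    K.stateSum β = sectionSum (S.map (Vertex.smoothings β K.color)) (fun r =>
        tangleBracket β (K.color ∘ g) I B T fun m =>
          β.δ ^ numClasses ((B : Multiset ι).map g + S.outs)
            ((m : Multiset (ι × ι)).map (Prod.map g g) + r)) *
      (DiagramCode.writheUnit (T : DiagramCode ι) β * S.writheUnit β : Rˣ) := by
  have hwr : K.writheFactor β
      = (DiagramCode.writheUnit (T : DiagramCode ι) β * S.writheUnit β : Rˣ) := by
    have h : DiagramCode.writheUnit (Multiset.map (Vertex.map g) (T : Multiset (Vertex ι))) β
        = DiagramCode.writheUnit (T : DiagramCode ι) β := by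
      simp only [DiagramCode.writheUnit,
        DiagramCode.numCrossings_map _ (Vertex.isCrossing_map _ g)]
    rw [← h, ← DiagramCode.writheUnit_add, ← hK]
    rfl
  have hins : K.code.ins = (DiagramCode.ins (T : DiagramCode ι)).map g + S.ins := by
    rw [hK, DiagramCode.ins_add, DiagramCode.ins_map]
  have houts : K.code.outs = (DiagramCode.outs (T : DiagramCode ι)).map g + S.outs := by
    rw [hK, DiagramCode.outs_add, DiagramCode.outs_map]
  have hnout := K.nodup
  have hnin := K.nodup
  rw [houts] at hnout
  rw [← K.closed, hins] at hnin
  obtain ⟨hnin, -, hdin⟩ := Multiset.nodup_add.1 hnin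
  obtain ⟨hnout, -, hdout⟩ := Multiset.nodup_add.1 hnout
  -- An inner label both ends and begins a semiarc in `T`, and every label of `T` does one of the
  -- two, so that the labels in question are compared within the same duplicate-free multiset.
  have hg : ∀ p ∈ I, ∀ q, q ∈ I ∨ q ∈ B → q ≠ p → g q ≠ g p := by
    intro p hp q hq hqp h
    have hq : q ∈ DiagramCode.ins (T : DiagramCode ι) ∨ q ∈ DiagramCode.outs (T : DiagramCode ι) :=
      hq.elim (fun hq => .inl (hT.inner_ins q hq)) (hT.boundary q)
    rcases hq with hq | hq
    · exact hqp (Multiset.inj_on_of_nodup_map hnin _ hq _ (hT.inner_ins p hp) h)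
    · exact hqp (Multiset.inj_on_of_nodup_map hnout _ hq _ (hT.inner_outs p hp) h)
  have hpin : ∀ p ∈ I, g p ∉ S.ins := fun p hp =>
    Multiset.disjoint_left.1 hdin (Multiset.mem_map_of_mem g (hT.inner_ins p hp))
  have hpout : ∀ p ∈ I, g p ∉ S.outs := fun p hp =>
    Multiset.disjoint_left.1 hdout (Multiset.mem_map_of_mem g (hT.inner_outs p hp))
  have hO : ∀ p ∈ I, g p ∉ (B : Multiset ι).map g + S.outs := by
    intro p hp h
    rcases Multiset.mem_add.1 h with h | h
    · obtain ⟨b, hb, h⟩ := Multiset.mem_map.1 h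
      exact hg p hp b (.inr hb) (fun hbp => hT.disjoint p hp (hbp ▸ hb)) h
    · exact hpout p hp h
  have hS : ∀ a, a ∈ K.code.outs
      ↔ a ∈ (I : Multiset ι).map g + ((B : Multiset ι).map g + S.outs) := by
    intro a
    simp only [Multiset.mem_add, Multiset.mem_map, Multiset.mem_coe]
    constructor
    · intro h
      rw [houts, Multiset.mem_add, Multiset.mem_map] at h
      rcases h with ⟨i, hi, rfl⟩ | h
      · exact (hT.outs_sub i hi).imp (fun h => ⟨i, h, rfl⟩) fun h => .inl ⟨i, h, rfl⟩
      · exact .inr (.inr h)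
    · have hm : ∀ i, i ∈ DiagramCode.ins (T : DiagramCode ι) ∨
          i ∈ DiagramCode.outs (T : DiagramCode ι) → g i ∈ K.code.outs := by
        rintro i (hi | hi)
        · rw [← K.closed, hins]
          exact Multiset.mem_add.2 (.inl (Multiset.mem_map_of_mem g hi))
        · rw [houts]
          exact Multiset.mem_add.2 (.inl (Multiset.mem_map_of_mem g hi))
      rintro (⟨i, hi, rfl⟩ | ⟨i, hi, rfl⟩ | h)
      · exact hm i (.inl (hT.inner_ins i hi))
      · exact hm i (hT.boundary i hi)
      · rw [houts]
        exact Multiset.mem_add.2 (.inr h)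
  rw [K.stateSum_eq_sectionSum, hwr]
  congr 1
  rw [show K.code.map (Vertex.smoothings β K.color) = _ from congrArg _ hK, Multiset.map_add,
    sectionSum_add]
  -- The states of the rest join semiarcs of the rest, hence no inner ones of the tangle.
  refine sectionSum_congr (fun e => ∀ p ∈ I, e.1 ≠ g p ∧ e.2 ≠ g p) ?_ ?_
  · intro s hs c hc e he p hp
    obtain ⟨v, hv, rfl⟩ := Multiset.mem_map.1 hs
    have hne : ∀ u ∈ v.ins + v.outs, u ≠ g p := by
      rintro u hu rfl
      rcases Multiset.mem_add.1 hu with hu | hu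
      · exact hpin p hp (Multiset.mem_bind.2 ⟨v, hv, hu⟩)
      · exact hpout p hp (Multiset.mem_bind.2 ⟨v, hv, hu⟩)
    have := Vertex.mem_of_mem_smoothings β _ hc he
    exact ⟨hne _ this.1, hne _ this.2⟩
  · intro r hr
    have hsm : ((T : Multiset (Vertex ι)).map (Vertex.map g)).map (Vertex.smoothings β K.color)
        = ((T : Multiset (Vertex ι)).map (Vertex.smoothings β (K.color ∘ g))).map
          (Multiset.map (Prod.map id (Multiset.map (Prod.map g g)))) := by
      rw [Multiset.map_map, Multiset.map_map]
      exact Multiset.map_congr rfl fun v _ => Vertex.smoothings_map β g K.color v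
    rw [hsm, sectionSum_map, sectionSum_tangle, tangleBracket]
    refine congrArg List.sum (List.map_congr_left fun c hc => congrArg _ ?_)
    have hl : ∀ e ∈ c.2, (e.1 ∈ I ∨ e.1 ∈ B) ∧ (e.2 ∈ I ∨ e.2 ∈ B) := by
      intro e he
      obtain ⟨v, hv, h⟩ := mem_of_mem_tangleStates β _ hc he
      have hm : ∀ u ∈ v.ins + v.outs, u ∈ I ∨ u ∈ B := by
        intro u hu
        rcases Multiset.mem_add.1 hu with hu | hu
        · exact hT.ins_sub u (Multiset.mem_bind.2 ⟨v, hv, hu⟩)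
        · exact hT.outs_sub u (Multiset.mem_bind.2 ⟨v, hv, hu⟩)
      exact ⟨hm _ h.1, hm _ h.2⟩
    obtain ⟨h1, h2⟩ := numClasses_elimLabels g B ((B : Multiset ι).map g + S.outs) r I c.2
      hT.nodup (fun b hb => Multiset.mem_add.2 (.inl (Multiset.mem_map_of_mem g hb))) hl hg hO
      fun p hp e he => hr e he p hp
    rw [numClasses_congr (S' := (I : Multiset ι).map g + ((B : Multiset ι).map g + S.outs)) hS
      (fun a ha b hb h => .of_mem ((hS a).1 ha) ((hS b).1 hb) h)
      (fun a ha b hb h => .of_mem ((hS a).2 ha) ((hS b).2 hb) h), h1,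
      numClasses_canonicalPairs g B _ r _ h2, pow_add, mul_comm]

/-- Two tangles with the same boundary and with equal brackets, corrected by the writhe, can
replace each other. -/
theorem ColoredDiagram.stateSum_eq_of_tangleBracket_eq [DecidableEq ι]
    (β : BiquandleVirtualBracket X R) {K K' : ColoredDiagram X L} (g : ι → L)
    {T T' : List (Vertex ι)} {I I' B : List ι} (hT : IsTangle T I B) (hT' : IsTangle T' I' B)
    {S : DiagramCode L} (hK : K.code = (T : Multiset (Vertex ι)).map (Vertex.map g) + S)
    (hK' : K'.code = (T' : Multiset (Vertex ι)).map (Vertex.map g) + S)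
    (hS : ∀ e ∈ S.ins + S.outs, K'.color e = K.color e)
    (h : ∀ ev : List (ι × ι) → R,
      tangleBracket β (K.color ∘ g) I B T ev * (DiagramCode.writheUnit (T : DiagramCode ι) β : Rˣ)
        = tangleBracket β (K'.color ∘ g) I' B T' ev *
          (DiagramCode.writheUnit (T' : DiagramCode ι) β : Rˣ)) :
    K.stateSum β = K'.stateSum β := by
  have hsm : S.map (Vertex.smoothings β K'.color) = S.map (Vertex.smoothings β K.color) := by
    refine Multiset.map_congr rfl fun v hv => Vertex.smoothings_congr β fun e he => hS e ?_
    rw [Multiset.mem_add] at he ⊢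
    exact he.imp (fun h => Multiset.mem_bind.2 ⟨v, hv, h⟩)
      fun h => Multiset.mem_bind.2 ⟨v, hv, h⟩
  rw [K.stateSum_eq_tangleBracket β g hT S hK, K'.stateSum_eq_tangleBracket β g hT' S hK', hsm,
    Units.val_mul, Units.val_mul, ← mul_assoc, ← mul_assoc]
  simp only [sectionSum_mul_right, h]

end Tangles

/-! ### The local moves -/

/-- The labels that occur in the pictures of the local moves: the boundary labels `a`, ..., `f` and
the inner labels `p`, `q`, `r` on one side, `p'`, `q'`, `r'` on the other. Only in moves I the label
`e` is an inner one. -/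
inductive Port
  | a | b | c | d | e | f | p | q | r | p' | q' | r'
  deriving DecidableEq

/-- The assignment of given labels to the ports. -/
def Port.place {L : Type*} (a b c d e f p q r p' q' r' : L) : Port → L
  | .a => a | .b => b | .c => c | .d => d | .e => e | .f => f
  | .p => p | .q => q | .r => r | .p' => p' | .q' => q' | .r' => r'

section Moves

variable {X : Type*} [Biquandle X] {R : Type*} [CommRing R] {L : Type*}

/-- The tangles `T` and `T'`, with inner labels `I` and `I'`, have the same boundary labels `B`, and
their brackets, corrected by the writhe, are the same for all colorings that agree at the
boundary. -/
structure TangleMove {ι : Type*} [DecidableEq ι] (β : BiquandleVirtualBracket X R)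
    (I I' B : List ι) (T T' : List (Vertex ι)) : Prop where
  left : IsTangle T I B
  right : IsTangle T' I' B
  bracket_eq : ∀ f f' : ι → X, (∀ v ∈ T, v.IsColored f) → (∀ v ∈ T', v.IsColored f') →
    (∀ i ∈ B, f' i = f i) → ∀ ev : List (ι × ι) → R,
      tangleBracket β f I B T ev * (DiagramCode.writheUnit (T : DiagramCode ι) β : Rˣ)
        = tangleBracket β f' I' B T' ev *
          (DiagramCode.writheUnit (T' : DiagramCode ι) β : Rˣ)

theorem Vertex.isColored_map {ι : Type*} (g : ι → L) (f : L → X) (v : Vertex ι) :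
    (v.map g).IsColored f ↔ v.IsColored (f ∘ g) := by
  rcases v with ⟨_ | _ | _, bl, br, tl, tr⟩ | ⟨s, t⟩ <;> rfl

/-- A move of tangles can be carried out inside a colored diagram without changing the state sum. -/
theorem TangleMove.stateSum_eq {ι : Type*} [DecidableEq ι] {β : BiquandleVirtualBracket X R}
    {I I' B : List ι} {T T' : List (Vertex ι)} (h : TangleMove β I I' B T T')
    {K K' : ColoredDiagram X L} (g : ι → L) {S : DiagramCode L}
    (hK : K.code = (T : Multiset (Vertex ι)).map (Vertex.map g) + S)
    (hK' : K'.code = (T' : Multiset (Vertex ι)).map (Vertex.map g) + S)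
    (hB : ∀ e ∈ (B : Multiset ι).map g, K'.color e = K.color e)
    (hS : ∀ e ∈ S.ins + S.outs, K'.color e = K.color e) :
    K.stateSum β = K'.stateSum β := by
  refine K.stateSum_eq_of_tangleBracket_eq β g h.left h.right hK hK' hS
    (h.bracket_eq _ _ ?_ ?_ fun i hi => hB _ (Multiset.mem_map_of_mem g hi))
  · intro v hv
    rw [← Vertex.isColored_map]
    exact K.isColored _ (hK ▸ Multiset.mem_add.2 (.inl (Multiset.mem_map_of_mem _ hv)))
  · intro v hv
    rw [← Vertex.isColored_map]
    exact K'.isColored _ (hK' ▸ Multiset.mem_add.2 (.inl (Multiset.mem_map_of_mem _ hv)))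

/-- For tangles with the same writhe it is enough to compare the brackets. -/
theorem TangleMove.of_bracket_eq {ι : Type*} [DecidableEq ι] {β : BiquandleVirtualBracket X R}
    {I I' B : List ι} {T T' : List (Vertex ι)} (hT : IsTangle T I B) (hT' : IsTangle T' I' B)
    (hw : DiagramCode.writheUnit (T : DiagramCode ι) β
      = DiagramCode.writheUnit (T' : DiagramCode ι) β)
    (h : ∀ f f' : ι → X, (∀ v ∈ T, v.IsColored f) → (∀ v ∈ T', v.IsColored f') →
      (∀ i ∈ B, f' i = f i) → ∀ ev : List (ι × ι) → R,
        tangleBracket β f I B T ev = tangleBracket β f' I' B T' ev) :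
    TangleMove β I I' B T T' :=
  ⟨hT, hT', fun f f' hf hf' hB ev => by rw [hw, h f f' hf hf' hB ev]⟩

open Port

attribute [local simp] tangleBracket tangleStates Vertex.smoothingList canonicalPairs elimLabels
  elimLabel otherEnd collapse

/-! ### Moves I -/

theorem tangleMove_kinkRight (β : BiquandleVirtualBracket X R) (k : CrossingKind) :
    TangleMove β [] [e] [a, b] [.point a b] [.crossing k a e b e] := by
  refine ⟨by constructor <;> decide, by cases k <;> constructor <;> decide, ?_⟩
  intro f f' _ _ _ ev
  have hw : DiagramCode.writheUnit (([.point a b] : List (Vertex Port)) : DiagramCode Port) β = 1 :=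
    zpow_zero _
  rw [hw, Units.val_one]
  cases k with
  | pos =>
    have hw : DiagramCode.writheUnit
        (([.crossing .pos a e b e] : List (Vertex Port)) : DiagramCode Port) β = β.w⁻¹ :=
      zpow_neg_one _
    rw [hw]
    simp
    linear_combination ev [(a, b)] * (β.w⁻¹ : Rˣ) * β.i_i (f' e)
      - ev [(a, b)] * β.w.mul_inv
  | neg =>
    have hw : DiagramCode.writheUnit
        (([.crossing .neg a e b e] : List (Vertex Port)) : DiagramCode Port) β = β.w :=
      zpow_one _
    rw [hw]
    simp
    linear_combination ev [(a, b)] * β.w * β.i_ii (f' e) - ev [(a, b)] * β.w.mul_inv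
  | virt =>
    have hw : DiagramCode.writheUnit
        (([.crossing .virt a e b e] : List (Vertex Port)) : DiagramCode Port) β = 1 :=
      zpow_zero _
    rw [hw]
    simp

theorem tangleMove_kinkLeft (β : BiquandleVirtualBracket X R) (k : CrossingKind) :
    TangleMove β [] [e] [a, b] [.point a b] [.crossing k e a e b] := by
  refine ⟨by constructor <;> decide, by cases k <;> constructor <;> decide, ?_⟩
  intro f f' hf _ hB ev
  simp only [List.forall_mem_cons, List.not_mem_nil, IsEmpty.forall_iff, implies_true, and_true,
    Vertex.IsColored] at hf hB
  have hba : f' b = f' a := by rw [hB.1, hB.2, hf]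
  have hw : DiagramCode.writheUnit (([.point a b] : List (Vertex Port)) : DiagramCode Port) β = 1 :=
    zpow_zero _
  rw [hw, Units.val_one]
  cases k with
  | pos =>
    have hw : DiagramCode.writheUnit
        (([.crossing .pos e a e b] : List (Vertex Port)) : DiagramCode Port) β = β.w⁻¹ :=
      zpow_neg_one _
    rw [hw]
    simp
    rw [hba]
    linear_combination ev [(a, b)] * (β.w⁻¹ : Rˣ) * β.i_i (f' a)
      - ev [(a, b)] * β.w.mul_inv
  | neg =>
    have hw : DiagramCode.writheUnit
        (([.crossing .neg e a e b] : List (Vertex Port)) : DiagramCode Port) β = β.w :=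
      zpow_one _
    rw [hw]
    simp
    rw [hba]
    linear_combination ev [(a, b)] * β.w * β.i_ii (f' a) - ev [(a, b)] * β.w.mul_inv
  | virt =>
    have hw : DiagramCode.writheUnit
        (([.crossing .virt e a e b] : List (Vertex Port)) : DiagramCode Port) β = 1 :=
      zpow_zero _
    rw [hw]
    simp

/-! ### Moves II -/

/-- The equations `ii_i`, `ii_v` + `ii_iv` and `ii_iii` belong to the three ways to join the four
boundary labels in pairs. -/
theorem tangleMove_direct (β : BiquandleVirtualBracket X R) (k : CrossingKind) :
    TangleMove β [] [p, q] [a, b, c, d] [.point a c, .point b d]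
      [.crossing k a b p q, .crossing k.flip p q c d] := by
  refine .of_bracket_eq (by constructor <;> decide) (by cases k <;> constructor <;> decide)
    (by cases k <;> rfl) ?_
  intro f f' hf _ hB ev
  simp only [List.forall_mem_cons, List.not_mem_nil, IsEmpty.forall_iff, implies_true, and_true,
    Vertex.IsColored] at hf hB
  obtain ⟨hc, hd⟩ := hf
  obtain ⟨hBa, hBb, hBc, hBd⟩ := hB
  have hdb : f' d = f' b := by rw [hBd, hd, hBb]
  cases k with
  | pos =>
    simp [CrossingKind.flip]
    rw [hdb]
    linear_combination ev [(a, c), (b, d)] * β.ii_i (f' b) (f' q)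
      + ev [(a, b), (c, d)] * (β.ii_v (f' b) (f' q) + β.ii_iv (f' b) (f' q))
      + ev [(a, d), (b, c)] * β.ii_iii (f' b) (f' q)
  | neg =>
    simp [CrossingKind.flip]
    rw [hdb]
    linear_combination ev [(a, c), (b, d)] * β.ii_i (f' q) (f' b)
      + ev [(a, b), (c, d)] * (β.ii_v (f' q) (f' b) + β.ii_iv (f' q) (f' b))
      + ev [(a, d), (b, c)] * β.ii_iii (f' q) (f' b)
  | virt => simp [CrossingKind.flip]

/-- For opposite directions the roles of the smoothings with and against the orientation are
exchanged, hence `ii_ii`, `ii_vi` + `ii_iii` and `ii_iv` take the places of `ii_i`, `ii_v` + `ii_iv`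
and `ii_iii`. -/
theorem tangleMove_reverseUpDown (β : BiquandleVirtualBracket X R) (k : CrossingKind) :
    TangleMove β [] [p, q] [a, b, c, d] [.point a c, .point d b]
      [.crossing k q a p b, .crossing k.flip p d q c] := by
  refine .of_bracket_eq (by constructor <;> decide) (by cases k <;> constructor <;> decide)
    (by cases k <;> rfl) ?_
  intro f f' hf _ hB ev
  simp only [List.forall_mem_cons, List.not_mem_nil, IsEmpty.forall_iff, implies_true, and_true,
    Vertex.IsColored] at hf hB
  obtain ⟨hc, hd⟩ := hf
  obtain ⟨hBa, hBb, hBc, hBd⟩ := hB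
  have hca : f' c = f' a := by rw [hBc, hc, hBa]
  have hdb : f' d = f' b := by rw [hBd, ← hd, hBb]
  cases k with
  | pos =>
    simp [CrossingKind.flip]
    rw [hca, hdb]
    linear_combination ev [(a, c), (b, d)] * β.ii_ii (f' a) (f' b)
      + ev [(a, b), (c, d)] * (β.ii_vi (f' a) (f' b) + β.ii_iii (f' a) (f' b))
      + ev [(a, d), (b, c)] * β.ii_iv (f' a) (f' b)
  | neg =>
    simp [CrossingKind.flip]
    rw [hca, hdb]
    linear_combination ev [(a, c), (b, d)] * β.ii_ii (f' b) (f' a)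
      + ev [(a, b), (c, d)] * (β.ii_vi (f' b) (f' a) + β.ii_iii (f' b) (f' a))
      + ev [(a, d), (b, c)] * β.ii_iv (f' b) (f' a)
  | virt => simp [CrossingKind.flip]

theorem tangleMove_reverseDownUp (β : BiquandleVirtualBracket X R) (k : CrossingKind) :
    TangleMove β [] [p, q] [a, b, c, d] [.point a c, .point d b]
      [.crossing k a q b p, .crossing k.flip d p c q] := by
  refine .of_bracket_eq (by constructor <;> decide) (by cases k <;> constructor <;> decide)
    (by cases k <;> rfl) ?_
  intro f f' _ _ _ ev
  cases k with
  | pos =>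
    simp [CrossingKind.flip]
    linear_combination ev [(a, c), (b, d)] * β.ii_ii (f' q) (f' p)
      + ev [(a, b), (c, d)] * (β.ii_vi (f' q) (f' p) + β.ii_iii (f' q) (f' p))
      + ev [(a, d), (b, c)] * β.ii_iv (f' q) (f' p)
  | neg =>
    simp [CrossingKind.flip]
    linear_combination ev [(a, c), (b, d)] * β.ii_ii (f' p) (f' q)
      + ev [(a, b), (c, d)] * (β.ii_vi (f' p) (f' q) + β.ii_iii (f' p) (f' q))
      + ev [(a, d), (b, c)] * β.ii_iv (f' p) (f' q)
  | virt => simp [CrossingKind.flip]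

/-! ### Moves III -/

/-- The fifteen equations `iii_i`, ..., `iii_xv` belong to the fifteen ways to join the six
boundary labels in pairs; `x`, `y`, `z` are the colors of `c`, `q`, `f`. -/
theorem tangleMove_braid (β : BiquandleVirtualBracket X R) :
    TangleMove β [p, q, r] [p', q', r'] [a, b, c, d, e, .f]
      [.crossing .pos b c p q, .crossing .pos a p d r, .crossing .pos r q e .f]
      [.crossing .pos a b p' q', .crossing .pos q' c r' .f, .crossing .pos p' r' d e] := by
  refine .of_bracket_eq (by constructor <;> decide) (by constructor <;> decide) rfl ?_
  intro f f' hf hf' hB ev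
  simp only [List.forall_mem_cons, List.not_mem_nil, IsEmpty.forall_iff, implies_true, and_true,
    Vertex.IsColored] at hf hf' hB
  obtain ⟨⟨hp, hb⟩, -, he, hr⟩ := hf
  obtain ⟨-, ⟨hr', hq'⟩, -⟩ := hf'
  obtain ⟨-, hBb, hBc, -, hBe, hBf⟩ := hB
  rw [hBc, hBf] at hr' hq'
  simp
  rw [hr', hq', hBb, hBc, hBe, hBf, hp, hb, he, hr]
  generalize f c = x, f q = y, f .f = z
  linear_combination ev [(a, d), (b, e), (c, .f)] * β.iii_i x y z
    + ev [(a, d), (b, c), (e, .f)] * β.iii_ii x y z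
    + ev [(a, b), (c, .f), (d, e)] * β.iii_iii x y z
    + ev [(a, e), (b, d), (c, .f)] * β.iii_iv x y z
    + ev [(a, d), (b, .f), (c, e)] * β.iii_v x y z
    + ev [(a, .f), (b, c), (d, e)] * β.iii_vi x y z
    + ev [(a, b), (c, d), (e, .f)] * β.iii_vii x y z
    + ev [(a, e), (b, c), (d, .f)] * β.iii_viii x y z
    + ev [(a, b), (c, e), (d, .f)] * β.iii_ix x y z
    + ev [(a, c), (b, .f), (d, e)] * β.iii_x x y z
    + ev [(a, c), (b, d), (e, .f)] * β.iii_xi x y z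
    + ev [(a, e), (b, .f), (c, d)] * β.iii_xii x y z
    + ev [(a, .f), (b, d), (c, e)] * β.iii_xiii x y z
    + ev [(a, c), (b, e), (d, .f)] * β.iii_xiv x y z
    + ev [(a, .f), (b, e), (c, d)] * β.iii_xv x y z

/-! When a virtual strand passes a crossing, this crossing has the same colors on both sides, and
thus each of its smoothings the same coefficient. -/

theorem tangleMove_slideRight (β : BiquandleVirtualBracket X R) (k : CrossingKind) :
    TangleMove β [p, q, r] [p', q', r'] [a, b, c, d, e, .f]
      [.crossing k b c p q, .crossing .virt a p d r, .crossing .virt r q e .f]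
      [.crossing .virt a b p' q', .crossing .virt q' c r' .f, .crossing k p' r' d e] := by
  refine .of_bracket_eq (by cases k <;> constructor <;> decide)
    (by cases k <;> constructor <;> decide) (by cases k <;> rfl) ?_
  intro f f' hf hf' hB ev
  simp only [List.forall_mem_cons, List.not_mem_nil, IsEmpty.forall_iff, implies_true, and_true,
    Vertex.IsColored] at hf hf' hB
  obtain ⟨-, -, -, h₂⟩ := hf
  obtain ⟨-, ⟨-, h₁⟩, -⟩ := hf'
  obtain ⟨-, -, hBc, -, hBe, -⟩ := hB
  have hx : f' r' = f c := by rw [h₁, hBc]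
  have hy : f' e = f q := by rw [hBe, h₂]
  cases k <;> simp [hx, hy]

theorem tangleMove_slideLeft (β : BiquandleVirtualBracket X R) (k : CrossingKind) :
    TangleMove β [p, q, r] [p', q', r'] [a, b, c, d, e, .f]
      [.crossing k a b p q, .crossing .virt q c r .f, .crossing .virt p r d e]
      [.crossing .virt b c p' q', .crossing .virt a p' d r', .crossing k r' q' e .f] := by
  refine .of_bracket_eq (by cases k <;> constructor <;> decide)
    (by cases k <;> constructor <;> decide) (by cases k <;> rfl) ?_
  intro f f' hf hf' hB ev
  simp only [List.forall_mem_cons, List.not_mem_nil, IsEmpty.forall_iff, implies_true, and_true,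
    Vertex.IsColored] at hf hf' hB
  obtain ⟨-, ⟨h₂, -⟩, -⟩ := hf
  obtain ⟨⟨h₁, -⟩, -, -⟩ := hf'
  obtain ⟨-, hBb, -, -, -, hBf⟩ := hB
  have hx : f' q' = f b := by rw [h₁, hBb]
  have hy : f' .f = f q := by rw [hBf, h₂]
  cases k <;> simp [hx, hy]

theorem tangleMove_slideUp (β : BiquandleVirtualBracket X R) (k : CrossingKind) :
    TangleMove β [p, q, r] [p', q', r'] [a, b, c, d, e, .f]
      [.crossing .virt a b p q, .crossing k q c r .f, .crossing .virt p r d e]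
      [.crossing .virt b c p' q', .crossing k a p' d r', .crossing .virt r' q' e .f] := by
  refine .of_bracket_eq (by cases k <;> constructor <;> decide)
    (by cases k <;> constructor <;> decide) (by cases k <;> rfl) ?_
  intro f f' _ hf' hB ev
  simp only [List.forall_mem_cons, List.not_mem_nil, IsEmpty.forall_iff, implies_true, and_true,
    Vertex.IsColored] at hf' hB
  obtain ⟨⟨-, h₁⟩, -, h₂, -⟩ := hf'
  obtain ⟨-, -, hBc, -, -, hBf⟩ := hB
  have hx : f' p' = f c := by rw [h₁, hBc]
  have hy : f' r' = f .f := by rw [← h₂, hBf]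
  cases k <;> simp [hx, hy]

theorem tangleMove_slideDown (β : BiquandleVirtualBracket X R) (k : CrossingKind) :
    TangleMove β [p, q, r] [p', q', r'] [a, b, c, d, e, .f]
      [.crossing .virt q e r d, .crossing k p c q .f, .crossing .virt r a p b]
      [.crossing .virt e q' .f r', .crossing k a p' d q', .crossing .virt c r' b p'] := by
  refine .of_bracket_eq (by cases k <;> constructor <;> decide)
    (by cases k <;> constructor <;> decide) (by cases k <;> rfl) ?_
  intro f f' _ hf' hB ev
  simp only [List.forall_mem_cons, List.not_mem_nil, IsEmpty.forall_iff, implies_true, and_true,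
    Vertex.IsColored] at hf' hB
  obtain ⟨⟨-, h₂⟩, -, h₁, -⟩ := hf'
  obtain ⟨-, -, hBc, -, -, hBf⟩ := hB
  have hx : f' p' = f c := by rw [h₁, hBc]
  have hy : f' q' = f .f := by rw [← h₂, hBf]
  cases k <;> simp [hx, hy]

/-! ### Invariance -/

theorem LocalMove.stateSum_eq (β : BiquandleVirtualBracket X R) {K K' : ColoredDiagram X L}
    {P : Multiset L} {T T' S : DiagramCode L} (hT : LocalMove P T T') (hK : K.code = T + S)
    (hK' : K'.code = T' + S) (hP : ∀ e ∈ P, K'.color e = K.color e)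
    (hS : ∀ e ∈ S.ins + S.outs, K'.color e = K.color e) : K.stateSum β = K'.stateSum β := by
  -- Ports that do not occur in a move are sent to `a`.
  cases hT with
  | kinkRight k a b e =>
    exact (tangleMove_kinkRight β k).stateSum_eq (Port.place a b a a e a a a a a a a)
      hK hK' hP hS
  | kinkLeft k a b e =>
    exact (tangleMove_kinkLeft β k).stateSum_eq (Port.place a b a a e a a a a a a a)
      hK hK' hP hS
  | direct k a b c d p q =>
    exact (tangleMove_direct β k).stateSum_eq (Port.place a b c d a a p q a a a a)
      hK hK' hP hS
  | reverseUpDown k a b c d p q =>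
    exact (tangleMove_reverseUpDown β k).stateSum_eq (Port.place a b c d a a p q a a a a)
      hK hK' hP hS
  | reverseDownUp k a b c d p q =>
    exact (tangleMove_reverseDownUp β k).stateSum_eq (Port.place a b c d a a p q a a a a)
      hK hK' hP hS
  | braid a b c d e f p q r p' q' r' =>
    exact (tangleMove_braid β).stateSum_eq (Port.place a b c d e f p q r p' q' r')
      hK hK' hP hS
  | slideRight k a b c d e f p q r p' q' r' =>
    exact (tangleMove_slideRight β k).stateSum_eq (Port.place a b c d e f p q r p' q' r')
      hK hK' hP hS
  | slideLeft k a b c d e f p q r p' q' r' =>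
    exact (tangleMove_slideLeft β k).stateSum_eq (Port.place a b c d e f p q r p' q' r')
      hK hK' hP hS
  | slideUp k a b c d e f p q r p' q' r' =>
    exact (tangleMove_slideUp β k).stateSum_eq (Port.place a b c d e f p q r p' q' r')
      hK hK' hP hS
  | slideDown k a b c d e f p q r p' q' r' =>
    exact (tangleMove_slideDown β k).stateSum_eq (Port.place a b c d e f p q r p' q' r')
      hK hK' hP hS

theorem ColoredMove.stateSum_eq (β : BiquandleVirtualBracket X R) {K K' : ColoredDiagram X L}
    (h : ColoredMove K K') : K.stateSum β = K'.stateSum β := by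
  classical
  cases h with
  | reidemeister P T T' S hT hK hK' hP hS => exact hT.stateSum_eq β hK hK' hP hS
  | mark e e' he hK' he' hc =>
    refine (ColoredDiagram.stateSum_mark β e e' he ?_ he' hc).symm
    convert hK'
  | relabel σ hK' hc => exact (ColoredDiagram.stateSum_relabel β σ hK' hc).symm

end Moves

theorem mainTheorem1 {X : Type*} [Biquandle X] {R : Type*} [CommRing R]
    (β : BiquandleVirtualBracket X R) {L : Type*} (K K' : ColoredDiagram X L)
    (h : Relation.EqvGen ColoredMove K K') : K.stateSum β = K'.stateSum β := by
  induction h with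
  | rel _ _ h => exact h.stateSum_eq β
  | refl => rfl
  | symm _ _ _ ih => exact ih.symm
  | trans _ _ _ _ _ ih ih' => exact ih.trans ih'
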